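/- Let $m,n\ge 1$ and let $\Omega\subset\mathbb R^m$ be a smoothly bounded domain, i.e. a non-empty, connected, bounded open set such that every $p\in\partial\Omega$ has an open neighbourhood $U$ and a smooth function $\rho:U\to\mathbb R$ with $d\rho(p)\neq 0$ and $\Omega\cap U=\{\rho<0\}$. Let $\{A_\tau\}_{\tau\in\partial\Omega}$ be a family of convex bodies (non-empty compact convex sets) in $\mathbb R^n$ that is continuous with respect to the Hausdorff metric. For $x\in\Omega$ let $\mu_x$ be the harmonic measure on $\partial\Omega$ with respect to $x$, that is, the Borel probability measure on $\partial\Omega$ such that for every continuous $f:\partial\Omega\to\mathbb R$ the function $u$ that is continuous on $\overline\Omega$, harmonic in $\Omega$ and equal to $f$ on $\partial\Omega$ satisfies $u(x)=\int_{\partial\Omega}f\,d\mu_x$. Let $$A_x:=\int_{\partial\Omega}A_\tau\,d\mu_x(\tau)\qquad (x\in\Omega)$$ be the harmonic interpolation of the family, where the integral is the Minkowski integral: $A_x$ is the closed convex set whose support function is $\xi\mapsto\int_{\partial\Omega}h_{A_\tau}(\xi)\,d\mu_x(\tau)$, with $h_A(\xi)=\sup_{\zeta\in A}\zeta\cdot\xi$;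 equivalently, $A_x$ is the set of all $\zeta\in\mathbb R^n$ with $\zeta\cdot\xi\le\int_{\partial\Omega}h_{A_\tau}(\xi)\,d\mu_x(\tau)$ for every $\xi\in\mathbb R^n$. Then $x\mapsto |A_x|^{1/n}$, where $|\cdot|$ is the Lebesgue measure on $\mathbb R^n$, is superharmonic on $\Omega$: it is lower semicontinuous, and whenever $r>0$ and the closed ball $\overline{B}_r(x)$ is contained in $\Omega$, it is integrable over $\partial B_r(x)$ and $$|A_x|^{1/n}\ \ge\ \int_{\partial B_r(x)}|A_y|^{1/n}\,dS(y),$$ where $dS$ is the normalized surface measure on $\partial B_r(x)$. -/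

import Mathlib

open MeasureTheory InnerProductSpace Metric
open scoped ContDiff

/-- A smoothly bounded domain: a (nonempty) connected, bounded open set which near each of its
boundary points `p` is the sublevel set `{ρ < 0}` of a smooth function `ρ` with `dρ(p) ≠ 0`. -/
structure IsSmoothlyBoundedDomain {m : ℕ} (Ω : Set (EuclideanSpace ℝ (Fin m))) : Prop where
  isOpen : IsOpen Ω
  isConnected : IsConnected Ω
  isBounded : Bornology.IsBounded Ω
  smooth_boundary : ∀ p ∈ frontier Ω, ∃ (U : Set (EuclideanSpace ℝ (Fin m)))
    (ρ : EuclideanSpace ℝ (Fin m) → ℝ), IsOpen U ∧ p ∈ U ∧ ContDiffOn ℝ ∞ ρ U ∧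
      fderiv ℝ ρ p ≠ 0 ∧ Ω ∩ U = {y ∈ U | ρ y < 0}

/-- The support function `h_A(ξ) = sup_{ζ ∈ A} ⟨ζ, ξ⟩`. -/
noncomputable def supportFunction {n : ℕ} (A : Set (EuclideanSpace ℝ (Fin n)))
    (ξ : EuclideanSpace ℝ (Fin n)) : ℝ :=
  sSup ((fun ζ => inner ℝ ζ ξ) '' A)

/-- The closed convex set `A(h)` with support function `h`, when `h` is sublinear (convex and
positively homogeneous). -/
def bodyOfSupport {n : ℕ} (h : EuclideanSpace ℝ (Fin n) → ℝ) : Set (EuclideanSpace ℝ (Fin n)) :=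
  {ζ | ∀ ξ, inner ℝ ζ ξ ≤ h ξ}

/-- The Minkowski integral `∫ A_y dμ(y) := A(∫ h_{A_y} dμ(y))`. -/
noncomputable def minkowskiIntegral {n : ℕ} {D : Type*} [MeasurableSpace D] (μ : Measure D)
    (A : D → Set (EuclideanSpace ℝ (Fin n))) : Set (EuclideanSpace ℝ (Fin n)) :=
  bodyOfSupport (fun ξ => ∫ y, supportFunction (A y) ξ ∂μ)

/-- `μ` is the harmonic measure on `∂Ω` with respect to `x`: it is a Borel probability measure
on `∂Ω` and, for each continuous `f` on `∂Ω`, the solution `u` of the Dirichlet problem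
(`u` continuous on the closure of `Ω`, harmonic in `Ω`, equal to `f` on `∂Ω`)
has value `u x = ∫ f dμ`. -/
def IsHarmonicMeasure {m : ℕ} (Ω : Set (EuclideanSpace ℝ (Fin m)))
    (x : EuclideanSpace ℝ (Fin m)) (μ : Measure (frontier Ω)) : Prop :=
  IsProbabilityMeasure μ ∧
    ∀ f : C(frontier Ω, ℝ), ∃ u : EuclideanSpace ℝ (Fin m) → ℝ,
      HarmonicContOnCl u Ω ∧ (∀ τ : frontier Ω, u τ = f τ) ∧ u x = ∫ τ, f τ ∂μ

open Classical in
/-- The harmonic measure on `∂Ω` with respect to `x ∈ Ω`. It exists whenever `Ω` is a smoothly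
bounded domain in `ℝᵐ`, `m ≥ 1`, and is unique by the maximum principle for the solutions of the
Dirichlet problem together with the Riesz representation theorem. (The value `0` where there is no
harmonic measure is a mere convention.) -/
noncomputable def harmonicMeasure {m : ℕ} (Ω : Set (EuclideanSpace ℝ (Fin m)))
    (x : EuclideanSpace ℝ (Fin m)) : Measure (frontier Ω) :=
  if h : ∃ μ : Measure (frontier Ω), IsHarmonicMeasure Ω x μ then h.choose else 0

/-- The harmonic interpolation `A_x = ∫_{∂Ω} A_τ dμ_x(τ)` of a family of convex bodies. -/
noncomputable def harmonicInterpolation {m n : ℕ} (Ω : Set (EuclideanSpace ℝ (Fin m)))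
    (A : frontier Ω → ConvexBody (EuclideanSpace ℝ (Fin n)))
    (x : EuclideanSpace ℝ (Fin m)) : Set (EuclideanSpace ℝ (Fin n)) :=
  minkowskiIntegral (harmonicMeasure Ω x) (fun τ => (A τ : Set (EuclideanSpace ℝ (Fin n))))

/-- A real-valued function is superharmonic on the open set `Ω` if it is lower semicontinuous and,
for every closed ball in `Ω`, its average over the bounding sphere with respect to the normalized
surface measure exists and is at most its value at the centre. -/
structure IsSuperharmonicOn {m : ℕ} (u : EuclideanSpace ℝ (Fin m) → ℝ)
    (Ω : Set (EuclideanSpace ℝ (Fin m))) : Prop where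
  lowerSemicontinuousOn : LowerSemicontinuousOn u Ω
  integrable_sphere : ∀ x r, 0 < r → closedBall x r ⊆ Ω →
    Integrable (fun θ : sphere (0 : EuclideanSpace ℝ (Fin m)) 1 => u (x + r • (θ : _)))
      (volume : Measure (EuclideanSpace ℝ (Fin m))).toSphere
  average_le : ∀ x r, 0 < r → closedBall x r ⊆ Ω →
    ⨍ θ : sphere (0 : EuclideanSpace ℝ (Fin m)) 1, u (x + r • (θ : EuclideanSpace ℝ (Fin m)))
      ∂(volume : Measure (EuclideanSpace ℝ (Fin m))).toSphere ≤ u x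

/-! Restrict support functions to the unit sphere S of ℝⁿ and let h_x be the average of the h_{A_τ}
against μ_x, taken in the Banach space C(S). By homogeneity, A_x is the Wulff shape W(h_x), the
intersection of the half-spaces ⟨ζ, ξ⟩ ≤ h_x(ξ) with ξ in S (`harmonicInterpolation_eq_wulffShape`).
That h_x is itself the support function of A_x is never needed.

Two facts carry the inequality. For fixed ξ the value h_x(ξ) is harmonic in x, so h_x is the average
of h_y over y in a sphere about x (`average_interpolatedSupport`). And |W(h)|^{1/n} is concave in h
where W(h) is nonempty (`concaveOn_wulffRadius`): s W(h) + t W(h') lies in W(s h + t h'), and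
Brunn–Minkowski applies. Jensen's inequality in C(S) combines the two. Continuity of |W(h)|^{1/n} in
h (`continuous_wulffRadius`) and of h_x in x (`continuousOn_interpolatedSupport`) yields
semicontinuity and integrability, and also what Jensen requires.

Since `harmonicMeasure` has a default value, harmonic measures must be shown to exist, which means
solving the Dirichlet problem. Mean value inequalities follow from Green's identity against radial
cut-offs, and the maximum principle follows from them. On a ball, polynomial data are handled by
linear algebra and general data by Stone–Weierstrass. On Ω, Poincaré's sweeping out produces the
solution, and exterior balls at boundary points give the barriers. The Riesz–Markov theorem then
supplies the measure. Brunn–Minkowski is derived from the Prékopa–Leindler inequality. -/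

/-! ### The Laplacian as a sum of second directional derivatives. -/

section LaplacianFormulas

variable {E : Type*} [NormedAddCommGroup E] [InnerProductSpace ℝ E] [FiniteDimensional ℝ E]

open Laplacian

theorem laplacian_comp_const_add (u : E → ℝ) (x y : E) :
    Δ (fun z => u (x + z)) y = Δ u (x + y) := by
  simp only [laplacian_eq_iteratedFDeriv_stdOrthonormalBasis]
  simp [iteratedFDeriv_comp_add_left]

theorem laplacian_eq_sum_fderiv_fderiv {ι : Type*} [Fintype ι] (b : OrthonormalBasis ι ℝ E)
    {u : E → ℝ} (hu : ContDiff ℝ 2 u) (y : E) :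
    Δ u y = ∑ i, fderiv ℝ (fun z => fderiv ℝ u z (b i)) y (b i) := by
  rw [laplacian_eq_iteratedFDeriv_orthonormalBasis u b]
  refine Finset.sum_congr rfl fun i _ => ?_
  have hd : DifferentiableAt ℝ (fderiv ℝ u) y :=
    (hu.fderiv_right (m := 1) (by norm_num)).differentiable (by norm_num) y
  rw [iteratedFDeriv_two_apply, fderiv_clm_apply hd (differentiableAt_const _)]
  simp

end LaplacianFormulas

/-! ### Polar coordinates, Green's identity and spherical mean values. -/

section PolarCoordinates

variable {E : Type*} [NormedAddCommGroup E] [InnerProductSpace ℝ E] [FiniteDimensional ℝ E]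
  [MeasurableSpace E] [BorelSpace E]

open Set Laplacian Module

theorem integral_eq_integral_Ioi_toSphere [Nontrivial E] {f : E → ℝ} (hf : Integrable f) :
    ∫ x, f x = ∫ r in Ioi (0 : ℝ), r ^ (finrank ℝ E - 1) *
      ∫ θ : sphere (0 : E) 1, f (r • (θ : E)) ∂(volume : Measure E).toSphere := by
  have hmp := (volume : Measure E).measurePreserving_homeomorphUnitSphereProd
  have hemb := (homeomorphUnitSphereProd E).measurableEmbedding
  set G : sphere (0 : E) 1 × Ioi (0 : ℝ) → ℝ := fun p => f ((p.2 : ℝ) • (p.1 : E)) with hG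
  have hGc : ∀ x : ({(0)}ᶜ : Set E), G (homeomorphUnitSphereProd E x) = f x := by
    intro x
    have hx : ‖(x : E)‖ ≠ 0 := norm_ne_zero_iff.2 x.2
    simp [hG, homeomorphUnitSphereProd_apply_fst_coe, homeomorphUnitSphereProd_apply_snd_coe,
      smul_smul, hx]
  have hGi : Integrable G ((volume : Measure E).toSphere.prod
      (Measure.volumeIoiPow (finrank ℝ E - 1))) := by
    rw [← hmp.integrable_comp_emb hemb]
    have : G ∘ (homeomorphUnitSphereProd E) = f ∘ (Subtype.val : ({(0)}ᶜ : Set E) → E) := by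
      funext x; exact hGc x
    rw [this, ← integrableOn_iff_comap_subtypeVal (measurableSet_singleton _).compl]
    exact hf.integrableOn
  calc ∫ x, f x = ∫ x : ({(0)}ᶜ : Set E), f x ∂(Measure.comap (↑) (volume : Measure E)) := by
        rw [integral_subtype_comap (measurableSet_singleton _).compl f, restrict_compl_singleton]
    _ = ∫ p, G p ∂((volume : Measure E).toSphere.prod
          (Measure.volumeIoiPow (finrank ℝ E - 1))) := by
        rw [← hmp.integral_comp hemb]
        exact integral_congr_ae (.of_forall fun x => (hGc x).symm)
    _ = ∫ r : Ioi (0 : ℝ), ∫ θ : sphere (0 : E) 1, f ((r : ℝ) • (θ : E))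
          ∂(volume : Measure E).toSphere ∂(Measure.volumeIoiPow (finrank ℝ E - 1)) :=
        integral_prod_symm _ hGi
    _ = _ := by
        simp only [Measure.volumeIoiPow, ENNReal.ofReal]
        rw [integral_withDensity_eq_integral_smul
            ((measurable_subtype_coe.pow_const _).real_toNNReal),
          integral_subtype_comap measurableSet_Ioi fun a : ℝ => Real.toNNReal
            (a ^ (finrank ℝ E - 1)) • ∫ θ : sphere (0 : E) 1, f (a • (θ : E))
            ∂(volume : Measure E).toSphere]
        refine setIntegral_congr_fun measurableSet_Ioi fun x hx => ?_
        simp only [NNReal.smul_def, Real.coe_toNNReal _ (pow_nonneg hx.out.le _), smul_eq_mul]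

/-- Green's identity for a radial cut-off function. -/
theorem integral_comp_normSq_mul_laplacian {u : E → ℝ} (hu : ContDiff ℝ 2 u) {k k' : ℝ → ℝ}
    (hk : ∀ t, HasDerivAt k (k' t) t) (hk' : Continuous k') {b : ℝ} (hb : ∀ t, b ≤ t → k t = 0) :
    ∫ y, k (‖y‖ ^ 2) * Δ u y = -∫ y, 2 * k' (‖y‖ ^ 2) * fderiv ℝ u y y := by
  have hkc : Continuous k := continuous_iff_continuousAt.2 fun t => (hk t).continuousAt
  have hb' : ∀ t, b < t → k' t = 0 := fun t ht => by
    have h1 : k =ᶠ[nhds t] fun _ => 0 := by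
      filter_upwards [lt_mem_nhds ht] with s hs using hb s hs.le
    exact (hk t).unique ((hasDerivAt_const t (0 : ℝ)).congr_of_eventuallyEq h1)
  -- The radius |b| + 1 works for every sign and size of `b`, since (|b| + 1)² > b.
  have hK : ∀ {f : E → ℝ}, (∀ y, b < ‖y‖ ^ 2 → f y = 0) → Continuous f → Integrable f := by
    intro f hf hc
    refine hc.integrable_of_hasCompactSupport ?_
    refine HasCompactSupport.of_support_subset_isCompact
      (isCompact_closedBall (0 : E) (|b| + 1)) fun y hy => ?_
    rw [mem_closedBall, dist_zero_right]
    by_contra! h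
    refine hy (hf y ?_)
    nlinarith [le_abs_self b, abs_nonneg b]
  have hu1 : Continuous (fderiv ℝ u) := hu.continuous_fderiv (by norm_num)
  have hu2 : ∀ v, ContDiff ℝ 1 (fun z => fderiv ℝ u z v) := fun v =>
    (hu.fderiv_right (m := 1) (by norm_num)).clm_apply contDiff_const
  have hkd : ∀ y : E, HasFDerivAt (fun z : E => k (‖z‖ ^ 2))
      (k' (‖y‖ ^ 2) • (2 • (innerSL ℝ y))) y := fun y =>
    (hk _).comp_hasFDerivAt y (hasStrictFDerivAt_norm_sq y).hasFDerivAt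
  -- Integration by parts in one direction; summing over an orthonormal basis reassembles the
  -- Laplacian on one side and the radial derivative on the other.
  have hi : ∀ v : E, ∫ y, k (‖y‖ ^ 2) * fderiv ℝ (fun z => fderiv ℝ u z v) y v =
      -∫ y, 2 * k' (‖y‖ ^ 2) * (inner ℝ y v * fderiv ℝ u y v) := by
    intro v
    have c2 : Continuous fun y => fderiv ℝ (fun z => fderiv ℝ u z v) y v :=
      ((hu2 v).continuous_fderiv one_ne_zero).clm_apply continuous_const
    have := integral_mul_fderiv_eq_neg_fderiv_mul_of_integrable (μ := (volume : Measure E))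
      (f := fun z : E => k (‖z‖ ^ 2)) (g := fun z => fderiv ℝ u z v) (v := v) ?_ ?_ ?_
      (fun y _ => (hkd y).differentiableAt) (fun y _ => (hu2 v).differentiable one_ne_zero y)
    · rw [this]
      congr 1
      refine integral_congr_ae (.of_forall fun y => ?_)
      simp only [(hkd y).fderiv]
      simp
      ring
    · refine hK (fun y hy => ?_) ?_
      · simp [(hkd y).fderiv, hb' _ hy]
      · simp only [(hkd _).fderiv]
        simp
        fun_prop
    · exact hK (fun y hy => by simp [hb _ hy.le]) (by fun_prop)
    · exact hK (fun y hy => by simp [hb _ hy.le]) (by fun_prop)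
  have h1 : ∀ y, k (‖y‖ ^ 2) * Δ u y = ∑ i, k (‖y‖ ^ 2) *
      fderiv ℝ (fun z => fderiv ℝ u z (stdOrthonormalBasis ℝ E i)) y
      (stdOrthonormalBasis ℝ E i) := fun y => by
    rw [laplacian_eq_sum_fderiv_fderiv (stdOrthonormalBasis ℝ E) hu, Finset.mul_sum]
  have h2 : ∀ y, 2 * k' (‖y‖ ^ 2) * fderiv ℝ u y y = ∑ i, 2 * k' (‖y‖ ^ 2) *
      (inner ℝ y (stdOrthonormalBasis ℝ E i) * fderiv ℝ u y (stdOrthonormalBasis ℝ E i)) := by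
    intro y
    rw [← Finset.mul_sum]
    congr 1
    have h3 := congrArg (fderiv ℝ u y) ((stdOrthonormalBasis ℝ E).sum_repr y)
    rw [map_sum] at h3
    rw [← h3]
    refine Finset.sum_congr rfl fun i _ => ?_
    rw [map_smul, OrthonormalBasis.repr_apply_apply, smul_eq_mul, real_inner_comm]
  simp_rw [h1, h2]
  rw [integral_finsetSum, integral_finsetSum, ← Finset.sum_neg_distrib]
  · exact Finset.sum_congr rfl fun i _ => hi _
  · intro i _
    exact hK (fun y hy => by simp [hb' _ hy]) (by fun_prop)
  · intro i _
    have c2 : Continuous fun y => fderiv ℝ (fun z => fderiv ℝ u z (stdOrthonormalBasis ℝ E i)) y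
        (stdOrthonormalBasis ℝ E i) :=
      ((hu2 _).continuous_fderiv one_ne_zero).clm_apply continuous_const
    exact hK (fun y hy => by simp [hb _ hy.le]) (by fun_prop)

theorem hasDerivAt_integral_sphere {w : E → ℝ} (hw : ContDiff ℝ 1 w) (r : ℝ) :
    HasDerivAt (fun r : ℝ => ∫ θ : sphere (0 : E) 1, w (r • (θ : E))
        ∂(volume : Measure E).toSphere)
      (∫ θ : sphere (0 : E) 1, fderiv ℝ w (r • (θ : E)) θ ∂(volume : Measure E).toSphere) r := by
  have hc : Continuous (fderiv ℝ w) := hw.continuous_fderiv one_ne_zero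
  have hwc := hw.continuous
  obtain ⟨C, hC⟩ := ((isCompact_closedBall r 1).prod (isCompact_univ (X := sphere (0 : E) 1))
    ).exists_bound_of_continuousOn (f := fun p : ℝ × sphere (0 : E) 1 =>
      fderiv ℝ w (p.1 • (p.2 : E)) p.2) (by fun_prop)
  refine (hasDerivAt_integral_of_dominated_loc_of_deriv_le (𝕜 := ℝ) (E := ℝ)
    (F := fun (r : ℝ) (θ : sphere (0 : E) 1) => w (r • (θ : E)))
    (F' := fun (r : ℝ) (θ : sphere (0 : E) 1) => fderiv ℝ w (r • (θ : E)) θ) (bound := fun _ => C)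
    (μ := (volume : Measure E).toSphere) (ball_mem_nhds r one_pos) ?_ ?_ ?_ ?_ (integrable_const
      _) ?_).2
  · exact .of_forall fun x => (by fun_prop : Continuous _).aestronglyMeasurable
  · exact (by fun_prop : Continuous _).integrable_of_hasCompactSupport
      (HasCompactSupport.of_compactSpace _)
  · exact (by fun_prop : Continuous _).aestronglyMeasurable
  · exact .of_forall fun θ s hs => hC (s, θ) ⟨ball_subset_closedBall hs, mem_univ _⟩
  · refine .of_forall fun θ s _ => ?_
    have h1 : HasDerivAt (fun s : ℝ => s • (θ : E)) ((1 : ℝ) • (θ : E)) s :=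
      (hasDerivAt_id s).smul_const _
    rw [one_smul] at h1
    exact ((hw.differentiable one_ne_zero _).hasFDerivAt).comp_hasDerivAt s h1

theorem continuous_integral_sphere {F : ℝ → sphere (0 : E) 1 → ℝ}
    (hF : Continuous (Function.uncurry F)) :
    Continuous fun r => ∫ θ, F r θ ∂(volume : Measure E).toSphere :=
  continuous_parametric_integral_of_continuous (X := ℝ)
    (μ := (volume : Measure E).toSphere) (s := univ) hF isCompact_univ |>.congr
    fun r => by simp

/-- This replaces the divergence theorem on a ball. If the flux were negative at r, it would be
negative on some (r, r + ε). Green's identity with a weight that is nonincreasing in the radius and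
varies only in that shell then has a nonnegative left side, and in polar coordinates a negative
right side. -/
theorem integral_sphere_deriv_nonneg [Nontrivial E] {w : E → ℝ} (hw : ContDiff ℝ 2 w) {R : ℝ}
    (hΔ : ∀ y ∈ ball (0 : E) R, 0 ≤ Δ w y) {r : ℝ} (hr0 : 0 < r) (hrR : r < R) :
    0 ≤ ∫ θ : sphere (0 : E) 1, fderiv ℝ w (r • (θ : E)) θ ∂(volume : Measure E).toSphere := by
  set ψ : ℝ → ℝ := fun r => ∫ θ : sphere (0 : E) 1, fderiv ℝ w (r • (θ : E)) θ
    ∂(volume : Measure E).toSphere with hψ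
  have hfd : Continuous (fderiv ℝ w) := hw.continuous_fderiv (by norm_num)
  have hψc : Continuous ψ := continuous_integral_sphere
    (F := fun r (θ : sphere (0 : E) 1) => fderiv ℝ w (r • (θ : E)) θ)
      (by unfold Function.uncurry; fun_prop)
  by_contra! hneg
  obtain ⟨δ, hδ, hball⟩ := Metric.eventually_nhds_iff_ball.1
    ((hψc.tendsto r).eventually_lt_const hneg)
  -- The bound δ keeps the flux negative on the shell, and R - r keeps the weight supported where
  -- the Laplacian is known to be nonnegative.
  set ε := min (min δ r) (R - r) with hε
  have hε0 : 0 < ε := lt_min (lt_min hδ hr0) (sub_pos.2 hrR)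
  have hεδ : ε ≤ δ := (min_le_left _ _).trans (min_le_left _ _)
  have hεr : ε ≤ r := (min_le_left _ _).trans (min_le_right _ _)
  have hεR : ε ≤ R - r := min_le_right _ _
  set b := (r + ε) ^ 2 with hb
  set a := r ^ 2 with ha
  -- A continuous bump, positive exactly on (r², (r + ε)²); the weight k is its primitive vanishing
  -- beyond b.
  set κ : ℝ → ℝ := fun t => max (t - a) 0 * max (b - t) 0 with hκ
  have hκc : Continuous κ := by fun_prop
  have hκ0 : ∀ t, 0 ≤ κ t := fun t => by positivity
  set k : ℝ → ℝ := fun t => ∫ s in t..b, κ s with hk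
  have hkd : ∀ t, HasDerivAt k (-κ t) t := fun t =>
    intervalIntegral.integral_hasDerivAt_left (hκc.intervalIntegrable _ _)
      (hκc.stronglyMeasurableAtFilter _ _) hκc.continuousAt
  have hkb : ∀ t, b ≤ t → k t = 0 := fun t ht => by
    rw [hk]
    simp only
    rw [intervalIntegral.integral_symm, neg_eq_zero]
    refine intervalIntegral.integral_zero_ae (.of_forall fun s hs => ?_)
    rw [uIoc_of_le ht] at hs
    simp [hκ, hs.1.le]
  have hk0 : ∀ t, 0 ≤ k t := fun t => by
    rcases le_total b t with h | h
    · exact (hkb t h).ge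
    · exact intervalIntegral.integral_nonneg h fun s _ => hκ0 s
  have green := integral_comp_normSq_mul_laplacian hw hkd hκc.neg hkb
  have hpos : 0 ≤ ∫ y : E, k (‖y‖ ^ 2) * Δ w y := by
    refine integral_nonneg fun y => ?_
    by_cases hy : y ∈ ball (0 : E) R
    · exact mul_nonneg (hk0 _) (hΔ y hy)
    · rw [mem_ball, dist_zero_right, not_lt] at hy
      have : b ≤ ‖y‖ ^ 2 := by
        rw [hb]; gcongr; linarith
      simp [hkb _ this]
  have hint : Integrable fun y : E => 2 * -κ (‖y‖ ^ 2) * fderiv ℝ w y y := by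
    refine (by fun_prop : Continuous _).integrable_of_hasCompactSupport
      (HasCompactSupport.of_support_subset_isCompact (isCompact_closedBall (0 : E) R)
        fun y hy => ?_)
    rw [mem_closedBall, dist_zero_right]
    by_contra! h
    refine hy ?_
    have : b ≤ ‖y‖ ^ 2 := by
      rw [hb]; gcongr; linarith
    simp [hκ, this]
  rw [integral_eq_integral_Ioi_toSphere hint] at green
  set g : ℝ → ℝ := fun s => s ^ (finrank ℝ E - 1) * (2 * κ (s ^ 2)) * s * ψ s with hg
  have hgeq : ∀ s ∈ Ioi (0 : ℝ), s ^ (finrank ℝ E - 1) * ∫ θ : sphere (0 : E) 1,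
      2 * -κ (‖s • (θ : E)‖ ^ 2) * fderiv ℝ w (s • (θ : E)) (s • (θ : E))
      ∂(volume : Measure E).toSphere = - g s := by
    intro s hs
    have : ∀ θ : sphere (0 : E) 1, 2 * -κ (‖s • (θ : E)‖ ^ 2) *
        fderiv ℝ w (s • (θ : E)) (s • (θ : E)) =
        (-(2 * κ (s ^ 2) * s)) * fderiv ℝ w (s • (θ : E)) θ := fun θ => by
      rw [norm_smul, norm_eq_of_mem_sphere, mul_one, Real.norm_eq_abs, sq_abs, map_smul,
        smul_eq_mul]
      ring
    simp_rw [this]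
    rw [integral_const_mul]
    simp only [hg, hψ]
    ring
  rw [setIntegral_congr_fun measurableSet_Ioi hgeq, integral_neg, neg_neg] at green
  have hgc : Continuous g := by fun_prop
  have hsupp : ∀ s ∈ Ioi (0 : ℝ), s ∉ Ioo r (r + ε) → g s = 0 := by
    intro s hs hs'
    have : κ (s ^ 2) = 0 := by
      simp only [hκ, hb, ha]
      by_cases h1 : r < s
      · have h2 : r + ε ≤ s := by
          by_contra! h
          exact hs' ⟨h1, h⟩
        have : (r + ε) ^ 2 ≤ s ^ 2 := by gcongr
        simp [this]
      · have : s ^ 2 ≤ r ^ 2 := by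
          have := mem_Ioi.1 hs
          gcongr
          exact not_lt.1 h1
        simp [this]
    simp [hg, this]
  have hneg' : ∀ s ∈ Ioo r (r + ε), g s < 0 := by
    intro s hs
    have hs0 : 0 < s := hr0.trans hs.1
    have h1 : 0 < κ (s ^ 2) := by
      simp only [hκ, hb, ha]
      have : r ^ 2 < s ^ 2 := by have := hs.1; gcongr
      have : s ^ 2 < (r + ε) ^ 2 := by have := hs.2; gcongr
      exact mul_pos (lt_max_of_lt_left (by linarith)) (lt_max_of_lt_left (by linarith))
    have h2 : ψ s < 0 := hball s (by
      rw [mem_ball, Real.dist_eq, abs_of_pos (by linarith [hs.1])]; linarith [hs.2])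
    exact mul_neg_of_pos_of_neg (by positivity) h2
  have hIoo : ∫ s in Ioi (0 : ℝ), g s = ∫ s in Ioo r (r + ε), g s := by
    refine (setIntegral_eq_of_subset_of_forall_sdiff_eq_zero measurableSet_Ioi
      (fun s hs => hr0.trans hs.1) fun s hs => hsupp s hs.1 hs.2)
  have hfin : 0 < ∫ s in r..(r + ε), -g s :=
    intervalIntegral.intervalIntegral_pos_of_pos_on (hgc.neg.intervalIntegrable _ _)
      (fun s hs => neg_pos.2 (hneg' s hs)) (by linarith)
  rw [intervalIntegral.integral_of_le (by linarith), integral_Ioc_eq_integral_Ioo, integral_neg]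
    at hfin
  rw [green, hIoo] at hpos
  linarith

/-- The radial derivative of the spherical integral is the flux just shown to be nonnegative, and at
radius 0 the integral is `w x` times the total mass. -/
theorem le_average_sphere_of_contDiff [Nontrivial E] {w : E → ℝ} (hw : ContDiff ℝ 2 w) {x : E}
    {R : ℝ} (hΔ : ∀ y ∈ ball x R, 0 ≤ Δ w y) {r : ℝ} (hr0 : 0 ≤ r) (hrR : r < R) :
    w x ≤ ⨍ θ : sphere (0 : E) 1, w (x + r • (θ : E)) ∂(volume : Measure E).toSphere := by
  have hw' : ContDiff ℝ 2 fun z => w (x + z) := hw.comp (contDiff_const.add contDiff_id)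
  have hmono : MonotoneOn (fun r : ℝ => ∫ θ : sphere (0 : E) 1, w (x + r • (θ : E))
      ∂(volume : Measure E).toSphere) (Icc 0 r) := by
    have hd := hasDerivAt_integral_sphere (hw'.of_le (by norm_num : (1 : WithTop ℕ∞) ≤ 2))
    refine monotoneOn_of_deriv_nonneg (convex_Icc _ _)
      (fun s _ => (hd s).continuousAt.continuousWithinAt)
      (fun s _ => (hd s).differentiableAt.differentiableWithinAt) fun s hs => ?_
    rw [interior_Icc] at hs
    rw [(hd s).deriv]
    refine integral_sphere_deriv_nonneg hw' (R := R) (fun y hy => ?_) hs.1 (hs.2.trans hrR)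
    rw [laplacian_comp_const_add]
    exact hΔ _ (by simpa [mem_ball, dist_eq_norm] using hy)
  have h := hmono (left_mem_Icc.2 hr0) (right_mem_Icc.2 hr0) hr0
  simp only [zero_smul, add_zero, integral_const, smul_eq_mul] at h
  rw [average_eq, smul_eq_mul]
  have hpos : 0 < (volume : Measure E).toSphere.real univ := by
    have : NeZero (volume : Measure E).toSphere := ⟨Measure.toSphere_ne_zero _⟩
    exact measureReal_univ_pos
  rw [inv_mul_eq_div, le_div_iff₀ hpos]
  linarith

/-- The sub-mean value property over spheres. -/
theorem le_average_sphere [Nontrivial E] {u : E → ℝ} {x : E}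
    {R : ℝ} (hu : ContDiffOn ℝ 2 u (ball x R)) (hΔ : ∀ y ∈ ball x R, 0 ≤ Δ u y) {r : ℝ}
    (hr0 : 0 ≤ r) (hrR : r < R) :
    u x ≤ ⨍ θ : sphere (0 : E) 1, u (x + r • (θ : E)) ∂(volume : Measure E).toSphere := by
  obtain ⟨r₁, h1, h2⟩ := exists_between hrR
  obtain ⟨r₂, h3, h4⟩ := exists_between h2
  -- The cut-off makes u globally C² without changing it on the closed ball of radius r₁ > r.
  let χ : ContDiffBump x := ⟨r₁, r₂, hr0.trans_lt h1, h3⟩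
  have hw : ContDiff ℝ 2 fun y => χ y * u y := by
    rw [contDiff_iff_contDiffAt]
    intro y
    by_cases hy : y ∈ ball x R
    · exact χ.contDiffAt.mul (hu.contDiffAt (isOpen_ball.mem_nhds hy))
    · have : (fun y => χ y * u y) =ᶠ[nhds y] fun _ => 0 := by
        have : (closedBall x r₂)ᶜ ∈ nhds y :=
          isClosed_closedBall.isOpen_compl.mem_nhds fun h => hy (closedBall_subset_ball h4 h)
        filter_upwards [this] with z hz
        rw [χ.zero_of_le_dist (le_of_lt (by simpa using hz)), zero_mul]
      exact contDiffAt_const.congr_of_eventuallyEq this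
  have heq : ∀ y ∈ closedBall x r₁, χ y * u y = u y := fun y hy => by
    rw [χ.one_of_mem_closedBall hy, one_mul]
  have := le_average_sphere_of_contDiff hw (x := x) (R := r₁) (fun y hy => by
    rw [(laplacian_congr_nhds (f₂ := u) (Filter.eventuallyEq_iff_exists_mem.2
      ⟨ball x r₁, isOpen_ball.mem_nhds hy,
        fun z hz => heq z (ball_subset_closedBall hz)⟩)).eq_of_nhds]
    exact hΔ y (ball_subset_ball h2.le hy)) hr0 h1
  rw [heq x (mem_closedBall_self (hr0.trans h1.le))] at this
  refine this.trans_eq (average_congr (.of_forall fun θ => heq _ ?_))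
  simp [norm_smul, abs_of_nonneg hr0, h1.le]

/-- The mean value property of harmonic functions. -/
theorem average_sphere_eq_of_harmonicOnNhd [Nontrivial E] {u : E → ℝ} {x : E}
    {R : ℝ} (hu : HarmonicOnNhd u (ball x R)) {r : ℝ} (hr0 : 0 ≤ r) (hrR : r < R) :
    ⨍ θ : sphere (0 : E) 1, u (x + r • (θ : E)) ∂(volume : Measure E).toSphere = u x := by
  refine le_antisymm ?_ (le_average_sphere hu.contDiffOn
    (fun y hy => (hu y hy).2.self_of_nhds.ge) hr0 hrR)
  have := le_average_sphere hu.neg.contDiffOn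
    (fun y hy => (hu.neg y hy).2.self_of_nhds.ge) hr0 hrR
  simp only [Pi.neg_apply, average_neg] at this
  linarith

end PolarCoordinates

/-! ### The Laplacian of radial functions. -/

section RadialLaplacian

variable {E : Type*} [NormedAddCommGroup E] [InnerProductSpace ℝ E] [FiniteDimensional ℝ E]

open Laplacian Module

theorem laplacian_comp_norm_sub_sq {g g' g'' : ℝ → ℝ} (hg : ∀ t, HasDerivAt g (g' t) t)
    (hg' : ∀ t, HasDerivAt g' (g'' t) t) (hgc : ContDiff ℝ 2 g) (c y : E) :
    Δ (fun z => g (‖z - c‖ ^ 2)) y =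
      4 * ‖y - c‖ ^ 2 * g'' (‖y - c‖ ^ 2) + 2 * finrank ℝ E * g' (‖y - c‖ ^ 2) := by
  have hcd : ContDiff ℝ 2 fun z : E => g (‖z‖ ^ 2) := hgc.comp (contDiff_norm_sq ℝ)
  have h1 : ∀ z : E, HasFDerivAt (fun z : E => g (‖z‖ ^ 2)) (g' (‖z‖ ^ 2) • (2 • innerSL ℝ z)) z :=
    fun z => (hg _).comp_hasFDerivAt z (hasStrictFDerivAt_norm_sq z).hasFDerivAt
  have h2 : ∀ z v : E, fderiv ℝ (fun x : E => g (‖x‖ ^ 2)) z v =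
      g' (‖z‖ ^ 2) * (2 * inner ℝ z v) := fun z v => by
    rw [(h1 z).fderiv]; simp
  have h3 : ∀ z v : E, fderiv ℝ (fun z => fderiv ℝ (fun x : E => g (‖x‖ ^ 2)) z v) z v =
      4 * g'' (‖z‖ ^ 2) * inner ℝ z v ^ 2 + 2 * g' (‖z‖ ^ 2) * ‖v‖ ^ 2 := fun z v => by
    simp only [h2]
    have d1 : HasFDerivAt (fun z : E => g' (‖z‖ ^ 2)) (g'' (‖z‖ ^ 2) • (2 • innerSL ℝ z)) z :=
      (hg' _).comp_hasFDerivAt z (hasStrictFDerivAt_norm_sq z).hasFDerivAt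
    have d2 : HasFDerivAt (fun z : E => 2 * inner ℝ z v) ((2 : ℝ) • innerSL ℝ v) z := by
      have := ((innerSL ℝ v).hasFDerivAt (x := z)).const_mul (2 : ℝ)
      refine this.congr_of_eventuallyEq (.of_forall fun w => ?_)
      simp [real_inner_comm]
    rw [(d1.fun_mul d2).fderiv]
    simp
    ring
  have h4 : ∀ z : E, Δ (fun z : E => g (‖z‖ ^ 2)) z =
      4 * ‖z‖ ^ 2 * g'' (‖z‖ ^ 2) + 2 * finrank ℝ E * g' (‖z‖ ^ 2) := fun z => by
    rw [laplacian_eq_sum_fderiv_fderiv (stdOrthonormalBasis ℝ E) hcd]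
    simp only [h3, Finset.sum_add_distrib, ← Finset.mul_sum]
    rw [(stdOrthonormalBasis ℝ E).sum_sq_inner_left]
    simp
    ring
  have h5 := laplacian_comp_const_add (fun z : E => g (‖z‖ ^ 2)) (-c) y
  simp only [neg_add_eq_sub] at h5
  rw [h5, h4]

theorem laplacian_norm_sub_sq (c y : E) : Δ (fun z : E => ‖z - c‖ ^ 2) y = 2 * finrank ℝ E := by
  have := laplacian_comp_norm_sub_sq (g := fun t => t) (g' := fun _ => 1) (g'' := fun _ => 0)
    (fun t => hasDerivAt_id t) (fun t => hasDerivAt_const t 1) contDiff_id c y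
  simpa using this

theorem continuous_laplacian {u : E → ℝ} (hu : ContDiff ℝ 2 u) : Continuous (Δ u) := by
  have : Δ u = fun y => ∑ i, fderiv ℝ (fun z => fderiv ℝ u z (stdOrthonormalBasis ℝ E i)) y
      (stdOrthonormalBasis ℝ E i) := funext (laplacian_eq_sum_fderiv_fderiv (stdOrthonormalBasis ℝ
        E) hu)
  rw [this]
  refine continuous_finsetSum _ fun i _ => ?_
  have hu2 : ContDiff ℝ 1 fun z => fderiv ℝ u z (stdOrthonormalBasis ℝ E i) :=
    (hu.fderiv_right (m := 1) (by norm_num)).clm_apply contDiff_const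
  exact (hu2.continuous_fderiv one_ne_zero).clm_apply continuous_const

end RadialLaplacian

/-! ### Small spheres inside an open set. -/

section SmallSpheres

open Set Filter Topology

theorem eventually_closedBall_subset_of_isOpen {E : Type*} [NormedAddCommGroup E] {U : Set E} (hU
    : IsOpen U) {x : E} (hx : x ∈ U) :
    ∀ᶠ r in 𝓝[>] (0 : ℝ), 0 < r ∧ closedBall x r ⊆ U := by
  obtain ⟨R, hR, hRU⟩ := Metric.isOpen_iff.1 hU x hx
  filter_upwards [Ioo_mem_nhdsGT hR] with r hr
  exact ⟨hr.1, (closedBall_subset_ball hr.2).trans hRU⟩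

theorem continuous_comp_sphere {E F : Type*} [NormedAddCommGroup E]
    [NormedSpace ℝ E] [TopologicalSpace F] {v : E → F} {U : Set E} (hv : ContinuousOn v U) {x : E}
      {r : ℝ}
    (hr : 0 ≤ r) (h : closedBall x r ⊆ U) :
    Continuous fun θ : sphere (0 : E) 1 => v (x + r • (θ : E)) := by
  refine hv.comp_continuous (by fun_prop) fun θ => h ?_
  simp [norm_smul, abs_of_nonneg hr]

end SmallSpheres

/-! ### The maximum principle and limits of harmonic functions. -/

section Submean

variable {E : Type*} [NormedAddCommGroup E] [InnerProductSpace ℝ E] [FiniteDimensional ℝ E]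
  [MeasurableSpace E] [BorelSpace E]

open Set Laplacian Module Filter Topology

/-- The local sub-mean value property at a point. -/
def SubmeanAt (v : E → ℝ) (x : E) : Prop :=
  ∀ᶠ r in 𝓝[>] (0 : ℝ),
    v x ≤ ⨍ θ : sphere (0 : E) 1, v (x + r • (θ : E)) ∂(volume : Measure E).toSphere

theorem integrable_comp_sphere {v : E → ℝ} {U : Set E} (hv : ContinuousOn v U) {x : E} {r : ℝ}
    (hr : 0 ≤ r) (h : closedBall x r ⊆ U) :
    Integrable (fun θ : sphere (0 : E) 1 => v (x + r • (θ : E)))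
      (volume : Measure E).toSphere :=
  (continuous_comp_sphere hv hr h).integrable_of_hasCompactSupport
    (HasCompactSupport.of_compactSpace _)

theorem average_add_sphere {f g : sphere (0 : E) 1 → ℝ}
    (hf : Integrable f (volume : Measure E).toSphere)
    (hg : Integrable g (volume : Measure E).toSphere) :
    ⨍ θ, (f θ + g θ) ∂(volume : Measure E).toSphere =
      ⨍ θ, f θ ∂(volume : Measure E).toSphere + ⨍ θ, g θ ∂(volume : Measure E).toSphere := by
  simp only [average_eq, integral_add hf hg, smul_eq_mul, mul_add]

theorem average_mono_sphere {f g : sphere (0 : E) 1 → ℝ}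
    (hf : Integrable f (volume : Measure E).toSphere)
    (hg : Integrable g (volume : Measure E).toSphere) (h : ∀ θ, f θ ≤ g θ) :
    ⨍ θ, f θ ∂(volume : Measure E).toSphere ≤ ⨍ θ, g θ ∂(volume : Measure E).toSphere := by
  simp only [average_eq, smul_eq_mul]
  exact mul_le_mul_of_nonneg_left (integral_mono hf hg h) (by positivity)

theorem SubmeanAt.add {v w : E → ℝ} {U : Set E} (hU : IsOpen U) {x : E} (hx : x ∈ U)
    (hv : SubmeanAt v x) (hw : SubmeanAt w x) (hvc : ContinuousOn v U) (hwc : ContinuousOn w U) :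
    SubmeanAt (fun y => v y + w y) x := by
  filter_upwards [hv, hw, eventually_closedBall_subset_of_isOpen hU hx] with r h1 h2 h3
  rw [average_add_sphere (integrable_comp_sphere hvc h3.1.le h3.2)
    (integrable_comp_sphere hwc h3.1.le h3.2)]
  exact add_le_add h1 h2

theorem submeanAt_of_laplacian_nonneg [Nontrivial E] {u : E → ℝ} {U : Set E} (hU : IsOpen U)
    (hu : ContDiffOn ℝ 2 u U) (hΔ : ∀ y ∈ U, 0 ≤ Δ u y) {x : E} (hx : x ∈ U) : SubmeanAt u x := by
  obtain ⟨R, hR, hRU⟩ := Metric.isOpen_iff.1 hU x hx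
  filter_upwards [Ioo_mem_nhdsGT hR] with r hr
  exact le_average_sphere (hu.mono hRU) (fun y hy => hΔ y (hRU hy)) hr.1.le hr.2

theorem submeanAt_of_harmonicOnNhd [Nontrivial E] {u : E → ℝ} {U : Set E} (hU : IsOpen U)
    (hu : HarmonicOnNhd u U) {x : E} (hx : x ∈ U) : SubmeanAt u x :=
  submeanAt_of_laplacian_nonneg hU hu.contDiffOn (fun y hy => (hu y hy).2.eq_of_nhds.ge) hx

/-- The maximum principle for functions with the local sub-mean value property. -/
theorem le_of_submeanAt [Nontrivial E] {v : E → ℝ} {U : Set E} (hb : Bornology.IsBounded U)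
    (hU : IsOpen U) (hc : ContinuousOn v (closure U)) (hs : ∀ x ∈ U, SubmeanAt v x) {c : ℝ}
    (hf : ∀ x ∈ frontier U, v x ≤ c) {x : E} (hx : x ∈ closure U) : v x ≤ c := by
  by_contra! hxc
  have hK : IsCompact (closure U) := hb.isCompact_closure
  obtain ⟨z, hz, hmax⟩ := hK.exists_isMaxOn ⟨x, hx⟩ hc
  have hcM : c < v z := hxc.trans_le (hmax hx)
  have hKc : IsCompact (closure U ∩ v ⁻¹' {v z}) :=
    hK.of_isClosed_subset (hc.preimage_isClosed_of_isClosed isClosed_closure isClosed_singleton)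
      inter_subset_left
  -- Among the maximum points take one farthest from the origin. The submean property makes a whole
  -- small sphere about it consist of maximum points, and that sphere contains a point of larger
  -- norm. This needs no connectedness of U.
  obtain ⟨p, ⟨hpU, hpz⟩, hpmax⟩ := hKc.exists_isMaxOn ⟨z, hz, rfl⟩ continuous_norm.continuousOn
  have hpz : v p = v z := hpz
  have hpU' : p ∈ U := by
    by_contra h
    have := hf p ⟨hpU, by rwa [hU.interior_eq]⟩
    linarith
  obtain ⟨r, hr, hr0, hrU⟩ :=
    ((hs p hpU').and (eventually_closedBall_subset_of_isOpen hU hpU')).exists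
  have hcU := hc.mono subset_closure
  set f : sphere (0 : E) 1 → ℝ := fun θ => v z - v (p + r • (θ : E)) with hfdef
  have hfc : Continuous f := continuous_const.sub (continuous_comp_sphere hcU hr0.le hrU)
  have hmem : ∀ θ : sphere (0 : E) 1, p + r • (θ : E) ∈ U := fun θ =>
    hrU (by simp [norm_smul, abs_of_pos hr0])
  have hf0 : 0 ≤ f := fun θ => sub_nonneg.2 (hmax (subset_closure (hmem θ)))
  have : NeZero (volume : Measure E).toSphere := ⟨Measure.toSphere_ne_zero _⟩
  have hpos : 0 < (volume : Measure E).toSphere.real univ := measureReal_univ_pos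
  have hint : ∫ θ, f θ ∂(volume : Measure E).toSphere ≤ 0 := by
    rw [hfdef, integral_sub (integrable_const _) (integrable_comp_sphere hcU hr0.le hrU),
      integral_const, smul_eq_mul]
    rw [average_eq, smul_eq_mul, inv_mul_eq_div, le_div_iff₀ hpos, hpz] at hr
    linarith
  have hfz : f = 0 := by
    by_contra hne
    obtain ⟨θ, hθ⟩ := Function.ne_iff.1 hne
    exact hint.not_gt (hfc.integral_pos_of_hasCompactSupport_nonneg_nonzero
      (HasCompactSupport.of_compactSpace _) hf0 hθ)
  have hle : ∀ θ : sphere (0 : E) 1, ‖p + r • (θ : E)‖ ≤ ‖p‖ := fun θ =>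
    hpmax ⟨subset_closure (hmem θ), (sub_eq_zero.1 (congrFun hfz θ)).symm⟩
  by_cases hp : p = 0
  · obtain ⟨θ, hθ⟩ := exists_norm_eq E (zero_le_one' ℝ)
    have := hle ⟨θ, by simpa using hθ⟩
    simp [hp, norm_smul, hθ] at this
    exact hr0.ne' this
  · have hp' : ‖p‖ ≠ 0 := norm_ne_zero_iff.2 hp
    have := hle ⟨‖p‖⁻¹ • p, by simp [norm_smul, hp']⟩
    have heq : p + r • (‖p‖⁻¹ • p) = ((‖p‖ + r) * ‖p‖⁻¹) • p := by
      rw [add_mul, add_smul, mul_inv_cancel₀ hp', one_smul, smul_smul]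
    simp only [heq, norm_smul, Real.norm_eq_abs] at this
    rw [abs_of_nonneg (by positivity), mul_assoc, inv_mul_cancel₀ hp', mul_one] at this
    linarith

theorem eq_of_harmonicContOnCl [Nontrivial E] {u v : E → ℝ} {U : Set E}
    (hb : Bornology.IsBounded U) (hU : IsOpen U) (hu : HarmonicContOnCl u U)
    (hv : HarmonicContOnCl v U) (h : ∀ x ∈ frontier U, u x = v x) {x : E} (hx : x ∈ closure U) :
    u x = v x := by
  have key : ∀ {u v : E → ℝ}, HarmonicContOnCl u U → HarmonicContOnCl v U →
      (∀ x ∈ frontier U, u x = v x) → u x ≤ v x := by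
    intro u v hu hv h
    have := le_of_submeanAt hb hU (hu.sub hv).2
      (fun y hy => submeanAt_of_harmonicOnNhd hU (hu.sub hv).1 hy) (c := 0)
      (fun y hy => by simp [h y hy]) hx
    simpa using this
  exact le_antisymm (key hu hv h) (key hv hu fun x hx => (h x hx).symm)

/-- The mean value property over radial weights. -/
theorem integral_radial_mul_of_harmonicOnNhd [Nontrivial E] {u : E → ℝ} {z : E} {R ρ : ℝ}
    (hu : HarmonicOnNhd u (ball z R)) (hρ : ρ < R) {g : ℝ → ℝ}
    (hg : Continuous g) (hgρ : ∀ t, ρ < t → g t = 0) :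
    ∫ y, g ‖y‖ * u (z + y) = u z * ∫ y : E, g ‖y‖ := by
  have hsupp : ∀ w : E → ℝ, ContinuousOn w (closedBall (0 : E) ρ) →
      Integrable fun y => g ‖y‖ * w y := by
    intro w hw
    have : IntegrableOn (fun y => g ‖y‖ * w y) (closedBall (0 : E) ρ) :=
      ((hg.comp continuous_norm).continuousOn.mul hw).integrableOn_compact
        (isCompact_closedBall _ _)
    refine (integrableOn_iff_integrable_of_support_subset fun y hy => ?_).1 this
    rw [mem_closedBall, dist_zero_right]
    by_contra! h
    exact hy (by simp [hgρ _ h])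
  have h1 : Integrable fun y => g ‖y‖ * u (z + y) := by
    refine hsupp (fun y => u (z + y)) ?_
    refine hu.continuousOn.comp (by fun_prop) fun y hy => ?_
    simp only [mem_ball, dist_self_add_left]
    exact lt_of_le_of_lt (by simpa using hy) hρ
  have h2 : Integrable fun y : E => g ‖y‖ := by simpa using hsupp (fun _ => 1) continuousOn_const
  have : NeZero (volume : Measure E).toSphere := ⟨Measure.toSphere_ne_zero _⟩
  have hpos : 0 < (volume : Measure E).toSphere.real univ := measureReal_univ_pos
  rw [integral_eq_integral_Ioi_toSphere h1, integral_eq_integral_Ioi_toSphere h2,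
    ← integral_const_mul]
  refine setIntegral_congr_fun measurableSet_Ioi fun r hr => ?_
  have hr : 0 < r := hr
  have hn : ∀ θ : sphere (0 : E) 1, ‖r • (θ : E)‖ = r := fun θ => by
    simp [norm_smul, abs_of_pos hr]
  simp only [hn, integral_const_mul, integral_const, smul_eq_mul]
  rcases lt_or_ge ρ r with h | h
  · simp [hgρ r h]
  · have := average_sphere_eq_of_harmonicOnNhd hu hr.le (h.trans_lt hρ)
    rw [average_eq, smul_eq_mul, inv_mul_eq_div, div_eq_iff hpos.ne'] at this
    rw [this]
    ring

/-- If Δw(x) > 0, subtract a small paraboloid a|y - x|² whose Laplacian is half of Δw(x). The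
difference is still subharmonic near x, so the averages of w exceed w(x) by at least a r², a
contradiction. -/
theorem laplacian_nonpos_of_average_le [Nontrivial E] {w : E → ℝ} (hw : ContDiff ℝ 2 w) {x : E}
    (h : ∀ᶠ r in 𝓝[>] (0 : ℝ),
      ⨍ θ : sphere (0 : E) 1, w (x + r • (θ : E)) ∂(volume : Measure E).toSphere ≤ w x) :
    Δ w x ≤ 0 := by
  by_contra! hpos
  set d : ℝ := (finrank ℝ E : ℝ) with hd
  have hd0 : 0 < d := by simp [hd, finrank_pos]
  obtain ⟨δ, hδ, hball⟩ := Metric.eventually_nhds_iff_ball.1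
    (((continuous_laplacian hw).tendsto x).eventually_const_lt (half_lt_self hpos))
  set q : E → ℝ := fun y => ‖y - x‖ ^ 2 with hq
  have hqc : ContDiff ℝ 2 q := (contDiff_norm_sq ℝ).comp (contDiff_id.sub contDiff_const)
  set a := Δ w x / (4 * d) with ha
  have ha0 : 0 < a := by positivity
  have hsub : SubmeanAt (w + (-a) • q) x := by
    refine submeanAt_of_laplacian_nonneg isOpen_ball (hw.add (hqc.const_smul (-a))).contDiffOn
      (fun y hy => ?_) (mem_ball_self hδ)
    have hlap : Δ (w + (-a) • q) y = Δ w y + -a * (2 * d) := by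
      have hq' : ContDiffAt ℝ 2 ((-a) • q) y := (hqc.const_smul (-a)).contDiffAt
      rw [hw.contDiffAt.laplacian_add hq',
        laplacian_smul _ hqc.contDiffAt, hq, laplacian_norm_sub_sq, smul_eq_mul]
    change 0 ≤ Δ (w + (-a) • q) y
    rw [hlap]
    have := hball y hy
    have : a * (2 * d) = Δ w x / 2 := by rw [ha]; field_simp; norm_num
    linarith
  obtain ⟨r, h1, h2, hr⟩ := (h.and (hsub.and self_mem_nhdsWithin)).exists
  have hr : 0 < r := hr
  have : NeZero (volume : Measure E).toSphere := ⟨Measure.toSphere_ne_zero _⟩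
  have hpos : 0 < (volume : Measure E).toSphere.real univ := measureReal_univ_pos
  have h3 : ∀ θ : sphere (0 : E) 1, (w + (-a) • q) (x + r • (θ : E)) =
      w (x + r • (θ : E)) + -(a * r ^ 2) := fun θ => by
    simp [hq, norm_smul]
  simp_rw [h3] at h2
  rw [average_add_sphere (integrable_comp_sphere (U := univ) hw.continuous.continuousOn hr.le
    (subset_univ _)) (integrable_const _), average_const] at h2
  simp [hq] at h2
  have : 0 < a * r ^ 2 := by positivity
  linarith

theorem average_sphere_eq_of_tendsto [Nontrivial E] {U : Set E} {u : ℕ → E → ℝ} {v : E → ℝ} {M : ℝ}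
    (hu : ∀ k, HarmonicOnNhd (u k) U) (hM : ∀ k, ∀ x ∈ U, |u k x| ≤ M)
    (hlim : ∀ x ∈ U, Tendsto (fun k => u k x) atTop (𝓝 (v x))) {x : E} {R r : ℝ}
    (hR : ball x R ⊆ U) (hr : 0 < r) (hrR : r < R) :
    ⨍ θ : sphere (0 : E) 1, v (x + r • (θ : E)) ∂(volume : Measure E).toSphere = v x := by
  have hmem : ∀ θ : sphere (0 : E) 1, x + r • (θ : E) ∈ U := fun θ =>
    hR (by simpa [norm_smul, abs_of_pos hr] using hrR)
  have h1 : Tendsto (fun k => ⨍ θ : sphere (0 : E) 1, u k (x + r • (θ : E))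
      ∂(volume : Measure E).toSphere) atTop (𝓝 (⨍ θ : sphere (0 : E) 1, v (x + r • (θ : E))
      ∂(volume : Measure E).toSphere)) := by
    simp only [average_eq]
    refine Tendsto.const_smul (tendsto_integral_of_dominated_convergence (fun _ => M)
      (fun k => ?_) (integrable_const M) (fun k => .of_forall fun θ => hM k _ (hmem θ))
      (.of_forall fun θ => hlim _ (hmem θ))) _
    exact (continuous_comp_sphere (hu k).continuousOn hr.le
      ((closedBall_subset_ball hrR).trans hR)).aestronglyMeasurable
  have h2 : ∀ k, ⨍ θ : sphere (0 : E) 1, u k (x + r • (θ : E))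
      ∂(volume : Measure E).toSphere = u k x := fun k =>
    average_sphere_eq_of_harmonicOnNhd ((hu k).mono hR) hr.le hrR
  simp only [h2] at h1
  exact tendsto_nhds_unique h1 (hlim x (hR (mem_ball_self (hr.trans hrR))))

/-- A bounded pointwise limit of harmonic functions is harmonic. -/
theorem harmonicOnNhd_of_tendsto [Nontrivial E] {U : Set E} (hU : IsOpen U) {u : ℕ → E → ℝ}
    {v : E → ℝ} {M : ℝ} (hu : ∀ k, HarmonicOnNhd (u k) U) (hM : ∀ k, ∀ x ∈ U, |u k x| ≤ M)
    (hlim : ∀ x ∈ U, Tendsto (fun k => u k x) atTop (𝓝 (v x))) : HarmonicOnNhd v U := by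
  intro x hx
  obtain ⟨R, hR, hRU⟩ := Metric.isOpen_iff.1 hU x hx
  set ρ := R / 4 with hρ
  have hρ0 : 0 < ρ := by positivity
  have hM0 : 0 ≤ M := (abs_nonneg _).trans (hM 0 x hx)
  -- A function of t², so that the radial mollifier φ is smooth at the origin too.
  set g : ℝ → ℝ := fun t => Real.smoothTransition (ρ ^ 2 - t ^ 2) with hg
  have hgρ : ∀ t, ρ < t → g t = 0 := fun t ht =>
    Real.smoothTransition.zero_of_nonpos (by nlinarith)
  set φ : E → ℝ := fun y => g ‖y‖ with hφ
  have hφc : ContDiff ℝ 2 φ :=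
    Real.smoothTransition.contDiff.comp (contDiff_const.sub (contDiff_norm_sq ℝ))
  have hφs : HasCompactSupport φ := by
    refine HasCompactSupport.of_support_subset_isCompact (isCompact_closedBall (0 : E) ρ)
      fun y hy => ?_
    rw [mem_closedBall, dist_zero_right]
    by_contra! h
    exact hy (hgρ _ h)
  have hφ0 : 0 ≤ φ := fun y => Real.smoothTransition.nonneg _
  have hφi : Integrable φ := hφc.continuous.integrable_of_hasCompactSupport hφs
  set c := ∫ y, φ y with hc
  have hc0 : 0 < c := by
    refine hφc.continuous.integral_pos_of_hasCompactSupport_nonneg_nonzero hφs hφ0 (x := 0) ?_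
    exact (Real.smoothTransition.pos_of_pos (by simpa using pow_pos hρ0 2)).ne'
  set B := closedBall x (2 * ρ) with hB
  have hBU : B ⊆ U := (closedBall_subset_ball (by rw [hρ]; linarith)).trans hRU
  have hlim' : ∀ y, Tendsto (fun k => B.indicator (u k) y) atTop (𝓝 (B.indicator v y)) := by
    intro y
    by_cases hy : y ∈ B
    · simpa only [indicator_of_mem hy] using hlim y (hBU hy)
    · simp only [indicator_of_notMem hy]
      exact tendsto_const_nhds
  have hmeas : ∀ k, Measurable (B.indicator (u k)) := fun k => by
    classical
    rw [← piecewise_eq_indicator]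
    exact ((hu k).continuousOn.mono hBU).measurable_piecewise continuousOn_const
      measurableSet_closedBall
  have hbd : ∀ k y, |B.indicator (u k) y| ≤ M := by
    intro k y
    by_cases hy : y ∈ B
    · simpa only [indicator_of_mem hy] using hM k y (hBU hy)
    · simpa only [indicator_of_notMem hy, abs_zero] using hM0
  have hvmeas : Measurable (B.indicator v) :=
    measurable_of_tendsto_metrizable hmeas (tendsto_pi_nhds.2 hlim')
  have hvbd : ∀ y, |B.indicator v y| ≤ M := fun y =>
    le_of_tendsto' ((hlim' y).abs) fun k => hbd k y
  have hvint : Integrable (B.indicator v) := by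
    have h1 : IntegrableOn (B.indicator v) B :=
      Measure.integrableOn_of_bounded (isCompact_closedBall _ _).measure_lt_top.ne
        hvmeas.aestronglyMeasurable (M := M) (.of_forall hvbd)
    exact (integrableOn_iff_integrable_of_support_subset support_indicator_subset).1 h1
  -- Each u_k reproduces itself under radial averaging, hence so does the limit v. Thus v agrees
  -- near x with its mollification w, which is C². The indicator of B only secures global
  -- measurability and integrability.
  set w : E → ℝ := fun z => c⁻¹ * ∫ y, φ y * B.indicator v (z + y) with hw
  have hwc : ContDiff ℝ 2 w := by
    have h1 := hφs.contDiff_convolution_left (ContinuousLinearMap.lsmul ℝ ℝ) (n := 2)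
      (by exact_mod_cast hφc) hvint.locallyIntegrable (μ := volume)
    have h2 : w = fun z => c⁻¹ * (convolution φ (B.indicator v)
        (ContinuousLinearMap.lsmul ℝ ℝ) volume) z := by
      funext z
      simp only [hw, convolution_def]
      rw [← integral_neg_eq_self]
      simp [hφ, sub_eq_add_neg]
    rw [h2]
    exact contDiff_const.mul (by exact_mod_cast h1)
  have hvw : ∀ z ∈ ball x ρ, v z = w z := by
    intro z hz
    have h1 : ∀ k, ∫ y, φ y * B.indicator (u k) (z + y) = u k z * c := by
      intro k
      rw [hc, ← integral_radial_mul_of_harmonicOnNhd (R := 2 * ρ) (g := g) ((hu k).mono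
        ((ball_subset_ball' ?_).trans hRU)) (by linarith)
        (Real.smoothTransition.continuous.comp (by fun_prop)) hgρ]
      · refine integral_congr_ae (.of_forall fun y => ?_)
        by_cases hy : ‖y‖ ≤ ρ
        · simp only
          rw [indicator_of_mem]
          rw [hB, mem_closedBall]
          calc dist (z + y) x ≤ dist (z + y) z + dist z x := dist_triangle _ _ _
            _ ≤ ρ + ρ := add_le_add (by simpa using hy) (mem_ball.1 hz).le
            _ = 2 * ρ := by ring
        · simp [hφ, hgρ _ (not_le.1 hy)]
      · have := mem_ball.1 hz
        linarith
    have h2 : Tendsto (fun k => ∫ y, φ y * B.indicator (u k) (z + y)) atTop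
        (𝓝 (∫ y, φ y * B.indicator v (z + y))) := by
      refine tendsto_integral_of_dominated_convergence (fun y => φ y * M) (fun k => ?_)
        (hφi.mul_const M) (fun k => .of_forall fun y => ?_)
        (.of_forall fun y => (hlim' _).const_mul _)
      · exact (hφc.continuous.measurable.mul
          ((hmeas k).comp (measurable_const_add z))).aestronglyMeasurable
      · rw [norm_mul, Real.norm_eq_abs, Real.norm_eq_abs, abs_of_nonneg (hφ0 y)]
        exact mul_le_mul_of_nonneg_left (hbd k _) (hφ0 y)
    simp only [h1] at h2
    have h3 := tendsto_nhds_unique h2 ((hlim z (hRU (ball_subset_ball (by linarith)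
      hz))).mul_const c)
    rw [hw]
    simp only [h3]
    field_simp
  have hev : ∀ z ∈ ball x ρ, v =ᶠ[𝓝 z] w := fun z hz =>
    Filter.eventuallyEq_iff_exists_mem.2 ⟨_, isOpen_ball.mem_nhds hz, hvw⟩
  -- The mean value equality passes to the limit, so the one-sided Laplacian test applies to both w
  -- and -w.
  have hlap : ∀ z ∈ ball x ρ, Δ w z = 0 := by
    intro z hz
    have havg : ∀ᶠ r in 𝓝[>] (0 : ℝ), ⨍ θ : sphere (0 : E) 1, w (z + r • (θ : E))
        ∂(volume : Measure E).toSphere = w z := by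
      filter_upwards [eventually_closedBall_subset_of_isOpen isOpen_ball hz,
        Ioo_mem_nhdsGT hρ0] with r hr hrρ
      rw [← hvw z hz, ← average_sphere_eq_of_tendsto hu hM hlim (x := z) (R := ρ) (r := r)
        ((ball_subset_ball' ?_).trans hRU) hr.1 hrρ.2]
      · refine average_congr (.of_forall fun θ => (hvw _ (hr.2 ?_)).symm)
        simp [norm_smul, abs_of_pos hr.1]
      · have := mem_ball.1 hz
        linarith
    refine le_antisymm (laplacian_nonpos_of_average_le hwc (havg.mono fun r hr => hr.le)) ?_
    have := laplacian_nonpos_of_average_le hwc.neg (x := z) (havg.mono fun r hr => by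
      rw [average_neg, hr])
    have hneg : Δ (-w) z = - Δ w z := congrFun (laplacian_neg (f := w)) z
    change Δ (-w) z ≤ 0 at this
    rw [hneg] at this
    linarith
  refine ⟨hwc.contDiffAt.congr_of_eventuallyEq (hev x (mem_ball_self hρ0)), ?_⟩
  filter_upwards [isOpen_ball.mem_nhds (mem_ball_self hρ0)] with z hz
  rw [(laplacian_congr_nhds (hev z hz)).eq_of_nhds, hlap z hz, Pi.zero_apply]

end Submean

/-! ### Polynomials as functions on Euclidean space. -/

section Polynomials

open Laplacian MvPolynomial Set

variable {m : ℕ}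

/-- The function on Euclidean space defined by a polynomial. -/
noncomputable def polyFun (p : MvPolynomial (Fin m) ℝ) (x : EuclideanSpace ℝ (Fin m)) : ℝ :=
  MvPolynomial.eval (fun i => x i) p

/-- The Laplace operator on polynomials. -/
noncomputable def polyLaplacian : MvPolynomial (Fin m) ℝ →ₗ[ℝ] MvPolynomial (Fin m) ℝ :=
  ∑ i, (pderiv i).toLinearMap ∘ₗ (pderiv i).toLinearMap

theorem hasFDerivAt_polyFun (p : MvPolynomial (Fin m) ℝ) (x : EuclideanSpace ℝ (Fin m)) :
    HasFDerivAt (polyFun p) (∑ i, polyFun (pderiv i p) x • EuclideanSpace.proj (𝕜 := ℝ) i) x := by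
  induction p using MvPolynomial.induction_on with
  | C a =>
    have : polyFun (C a : MvPolynomial (Fin m) ℝ) = fun _ => a := by
      funext y; simp [polyFun]
    rw [this]
    simpa [polyFun] using hasFDerivAt_const a x
  | add p q hp hq =>
    have h1 : polyFun (p + q) = fun y => polyFun p y + polyFun q y := by
      funext y; simp [polyFun]
    rw [h1]
    refine (hp.add hq).congr_fderiv ?_
    simp [polyFun, add_smul, Finset.sum_add_distrib]
  | mul_X p j hp =>
    have h1 : polyFun (p * X j) = fun y => polyFun p y * y j := by
      funext y; simp [polyFun]
    rw [h1]
    have h2 : HasFDerivAt (fun y : EuclideanSpace ℝ (Fin m) => y j)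
        (EuclideanSpace.proj (𝕜 := ℝ) j) x := (EuclideanSpace.proj (𝕜 := ℝ) j).hasFDerivAt
    refine (hp.mul h2).congr_fderiv ?_
    ext v
    classical
    simp only [polyFun, Derivation.leibniz, pderiv_X, Pi.single_apply, smul_eq_mul, map_add,
      map_mul,
      eval_X, add_apply, smul_apply,
      sum_apply, PiLp.proj_apply, add_mul, Finset.sum_add_distrib,
      Finset.mul_sum, apply_ite (eval fun i => x i), map_zero, mul_ite, mul_one, mul_zero,
      ite_mul, zero_mul, Finset.sum_ite_eq, Finset.mem_univ, if_true, mul_assoc]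

theorem contDiff_polyFun (p : MvPolynomial (Fin m) ℝ) : ContDiff ℝ 2 (polyFun p) := by
  induction p using MvPolynomial.induction_on with
  | C a =>
    have : polyFun (C a : MvPolynomial (Fin m) ℝ) = fun _ => a := by
      funext y; simp [polyFun]
    rw [this]
    exact contDiff_const
  | add p q hp hq =>
    have h1 : polyFun (p + q) = fun y => polyFun p y + polyFun q y := by
      funext y; simp [polyFun]
    rw [h1]
    exact hp.add hq
  | mul_X p j hp =>
    have h1 : polyFun (p * X j) = fun y => polyFun p y * y j := by
      funext y; simp [polyFun]
    rw [h1]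
    exact hp.mul (EuclideanSpace.proj (𝕜 := ℝ) j).contDiff

theorem laplacian_polyFun (p : MvPolynomial (Fin m) ℝ) :
    Δ (polyFun p) = polyFun (polyLaplacian p) := by
  funext y
  have h1 : ∀ (p : MvPolynomial (Fin m) ℝ) (x : EuclideanSpace ℝ (Fin m)) (i : Fin m),
      fderiv ℝ (polyFun p) x (EuclideanSpace.basisFun (Fin m) ℝ i) = polyFun (pderiv i p) x := by
    intro p x i
    rw [(hasFDerivAt_polyFun p x).fderiv]
    simp
  rw [laplacian_eq_sum_fderiv_fderiv (EuclideanSpace.basisFun (Fin m) ℝ) (contDiff_polyFun p)]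
  simp only [h1]
  simp [polyFun, polyLaplacian]

theorem totalDegree_pderiv_le (p : MvPolynomial (Fin m) ℝ) (i : Fin m) :
    (pderiv i p).totalDegree ≤ p.totalDegree - 1 := by
  refine Finset.sup_le fun s hs => ?_
  rw [mem_support_iff, coeff_pderiv] at hs
  have h1 : s + Finsupp.single i 1 ∈ p.support := mem_support_iff.2 (left_ne_zero_of_mul hs)
  have h2 := le_totalDegree h1
  rw [Finsupp.sum_add_index' (fun _ => rfl) (fun _ _ _ => rfl), Finsupp.sum_single_index rfl] at h2
  omega

theorem totalDegree_polyLaplacian_le (p : MvPolynomial (Fin m) ℝ) :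
    (polyLaplacian p).totalDegree ≤ p.totalDegree - 2 := by
  simp only [polyLaplacian, LinearMap.sum_apply]
  refine totalDegree_finsetSum_le fun i _ => ?_
  have h1 := totalDegree_pderiv_le p i
  have h2 := totalDegree_pderiv_le (pderiv i p) i
  simp only [LinearMap.comp_apply, Derivation.coeFn_coe]
  omega

/-- A Euclidean ball contains an open box, which is a product of infinite sets. -/
theorem eq_zero_of_polyFun_eq_zero_on_ball {p : MvPolynomial (Fin m) ℝ}
    {z : EuclideanSpace ℝ (Fin m)} {R : ℝ} (hR : 0 < R) (h : ∀ x ∈ ball z R, polyFun p x = 0) :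
    p = 0 := by
  have ho : IsOpen ((WithLp.toLp 2 : (Fin m → ℝ) → EuclideanSpace ℝ (Fin m)) ⁻¹' ball z R) :=
    isOpen_ball.preimage (PiLp.continuous_toLp 2 _)
  obtain ⟨δ, hδ, hsub⟩ := Metric.isOpen_iff.1 ho (WithLp.ofLp z) (by simp [hR])
  refine funext_set (fun i => ball (z i) δ) (fun i => ?_) fun x hx => ?_
  · rw [Real.ball_eq_Ioo]
    exact Ioo_infinite (by linarith)
  · rw [map_zero]
    refine h (WithLp.toLp 2 x) (hsub ?_)
    rw [ball_pi _ hδ]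
    exact hx

/-- Any continuous function on a compact subset of Euclidean space is uniformly approximated by
polynomials. -/
theorem exists_polyFun_near {K : Set (EuclideanSpace ℝ (Fin m))} (hK : IsCompact K)
    {f : EuclideanSpace ℝ (Fin m) → ℝ} (hf : ContinuousOn f K) {ε : ℝ} (hε : 0 < ε) :
    ∃ p : MvPolynomial (Fin m) ℝ, ∀ x ∈ K, |polyFun p x - f x| < ε := by
  have : CompactSpace K := isCompact_iff_compactSpace.1 hK
  let X' : Fin m → C(K, ℝ) := fun i => ⟨fun x => (x : EuclideanSpace ℝ (Fin m)) i, by fun_prop⟩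
  let A := (MvPolynomial.aeval (R := ℝ) X').range
  have hev : ∀ (p : MvPolynomial (Fin m) ℝ) (x : K), (MvPolynomial.aeval X' p) x = polyFun p x := by
    intro p x
    have := MvPolynomial.comp_aeval_apply (f := X') (φ := ContinuousMap.evalAlgHom ℝ ℝ x) p
    refine this.trans ?_
    rw [MvPolynomial.aeval_eq_eval]
    rfl
  have hsep : A.SeparatesPoints := by
    intro x y hxy
    have : ∃ i, (x : EuclideanSpace ℝ (Fin m)) i ≠ (y : EuclideanSpace ℝ (Fin m)) i := by
      by_contra! h
      exact hxy (Subtype.ext (PiLp.ext h))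
    obtain ⟨i, hi⟩ := this
    refine ⟨X' i, ⟨X' i, ⟨X i, by simp⟩, rfl⟩, hi⟩
  obtain ⟨⟨g, p, rfl⟩, hg⟩ := ContinuousMap.exists_mem_subalgebra_near_continuous_of_separatesPoints
    A hsep (K.domRestrict f) hf.domRestrict ε hε
  refine ⟨p, fun x hx => ?_⟩
  have := hg ⟨x, hx⟩
  have h2 := hev p ⟨x, hx⟩
  simp only [Real.norm_eq_abs] at this
  change |(MvPolynomial.aeval X' p) ⟨x, hx⟩ - f x| < ε at this
  rwa [h2] at this

end Polynomials

/-! ### The Dirichlet problem on balls. -/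

section DirichletBall

open Laplacian MvPolynomial Set Filter Topology

/-- By the maximum principle, closeness on the boundary controls closeness on the whole closure. The
approximate solutions are therefore uniformly Cauchy, and their limit is continuous and harmonic. -/
theorem exists_harmonicContOnCl_of_approx {E : Type*} [NormedAddCommGroup E]
    [InnerProductSpace ℝ E] [FiniteDimensional ℝ E] [MeasurableSpace E] [BorelSpace E]
    [Nontrivial E] {U : Set E} (hb : Bornology.IsBounded U) (hU : IsOpen U) {f : E → ℝ}
    (h : ∀ ε > 0, ∃ u, HarmonicContOnCl u U ∧ ∀ x ∈ frontier U, |u x - f x| ≤ ε) :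
    ∃ u, HarmonicContOnCl u U ∧ ∀ x ∈ frontier U, u x = f x := by
  choose! u hu huf using h
  set w : ℕ → E → ℝ := fun k => u (1 / (k + 1)) with hw
  have hpos : ∀ k : ℕ, (0 : ℝ) < 1 / (k + 1) := fun k => Nat.one_div_pos_of_nat
  have hwu : ∀ k, HarmonicContOnCl (w k) U := fun k => hu _ (hpos k)
  have hwf : ∀ k : ℕ, ∀ x ∈ frontier U, |w k x - f x| ≤ 1 / (k + 1) := fun k => huf _ (hpos k)
  have hle : ∀ k l : ℕ, ∀ x ∈ closure U, w k x - w l x ≤ 1 / ((k : ℝ) + 1) + 1 / (l + 1) := by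
    intro k l x hx
    refine le_of_submeanAt hb hU ((hwu k).sub (hwu l)).2
      (fun y hy => submeanAt_of_harmonicOnNhd hU ((hwu k).sub (hwu l)).1 hy) (fun y hy => ?_) hx
    have h1 := abs_le.1 (hwf k y hy)
    have h2 := abs_le.1 (hwf l y hy)
    simp only [Pi.sub_apply]
    linarith [h1.2, h2.1]
  have habs : ∀ k l : ℕ, ∀ x ∈ closure U, |w k x - w l x| ≤ 1 / ((k : ℝ) + 1) + 1 / (l + 1) :=
    fun k l x hx => abs_le.2 ⟨by linarith [hle l k x hx], hle k l x hx⟩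
  have hcau : UniformCauchySeqOn w atTop (closure U) := by
    rw [Metric.uniformCauchySeqOn_iff]
    intro ε hε
    obtain ⟨N, hN⟩ := exists_nat_one_div_lt (half_pos hε)
    refine ⟨N, fun k hk l hl x hx => ?_⟩
    rw [Real.dist_eq]
    have h1 : 1 / ((k : ℝ) + 1) ≤ 1 / (N + 1) := Nat.one_div_le_one_div hk
    have h2 : 1 / ((l : ℝ) + 1) ≤ 1 / (N + 1) := Nat.one_div_le_one_div hl
    linarith [habs k l x hx]
  have hlim : ∀ x ∈ closure U, ∃ y, Tendsto (fun k => w k x) atTop (𝓝 y) := fun x hx =>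
    cauchySeq_tendsto_of_complete (hcau.cauchySeq hx)
  choose! v hv using hlim
  have hunif := hcau.tendstoUniformlyOn_of_tendsto hv
  obtain ⟨M, hM⟩ := hb.isCompact_closure.exists_bound_of_continuousOn (hwu 0).2
  -- M bounds the first approximant, and any other differs from it by at most 1 + 1.
  refine ⟨v, ⟨harmonicOnNhd_of_tendsto hU (fun k => (hwu k).1) (M := M + 2) (fun k x hx => ?_)
    fun x hx => hv x (subset_closure hx), hunif.continuousOn
      (Frequently.of_forall fun k => (hwu k).2)⟩, fun x hx => ?_⟩
  · have h1 := hM x (subset_closure hx)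
    have h2 := habs k 0 x (subset_closure hx)
    have h3 : 1 / ((k : ℝ) + 1) ≤ 1 / ((0 : ℕ) + 1) := Nat.one_div_le_one_div (Nat.zero_le k)
    have h4 := abs_sub_abs_le_abs_sub (w k x) (w 0 x)
    rw [Real.norm_eq_abs] at h1
    norm_num at h2 h3
    linarith
  · have h1 : Tendsto (fun k => w k x) atTop (𝓝 (f x)) := by
      rw [tendsto_iff_dist_tendsto_zero]
      exact squeeze_zero (fun k => dist_nonneg) (fun k => hwf k x hx)
        tendsto_one_div_add_atTop_nhds_zero_nat
    exact tendsto_nhds_unique (hv x (frontier_subset_closure hx)) h1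

variable {m : ℕ}

/-- Let q = R² - |x - z|². The map s ↦ Δ(q s) preserves the finite-dimensional space of polynomials
of degree at most deg p. It is injective: if q s is harmonic then, vanishing on the sphere, it
vanishes in the ball, where q > 0. Hence it is surjective, and Δ(q s) = Δp makes p - q s the
required polynomial. -/
theorem exists_harmonic_polyFun_eq_on_sphere (hm : 1 ≤ m) (z : EuclideanSpace ℝ (Fin m)) {R : ℝ}
    (hR : 0 < R) (p : MvPolynomial (Fin m) ℝ) :
    ∃ h : MvPolynomial (Fin m) ℝ, polyLaplacian h = 0 ∧
      ∀ x ∈ sphere z R, polyFun h x = polyFun p x := by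
  have : Nonempty (Fin m) := ⟨⟨0, hm⟩⟩
  set q : MvPolynomial (Fin m) ℝ := C (R ^ 2) - ∑ i, (X i - C (z i)) ^ 2 with hq
  have hqx : ∀ x, polyFun q x = R ^ 2 - dist x z ^ 2 := fun x => by
    simp [polyFun, hq, EuclideanSpace.dist_eq, Real.sq_sqrt, Finset.sum_nonneg, sq_nonneg,
      Real.dist_eq, sq_abs]
  have hmul : ∀ a b : MvPolynomial (Fin m) ℝ, ∀ x, polyFun (a * b) x = polyFun a x * polyFun b x :=
    fun a b x => by simp [polyFun]
  have hqdeg : q.totalDegree ≤ 2 := by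
    refine (totalDegree_sub _ _).trans (max_le ((totalDegree_C _).le.trans zero_le_two)
      (totalDegree_finsetSum_le fun i _ => ?_))
    refine (totalDegree_pow _ _).trans ?_
    have : (X i - C (z i) : MvPolynomial (Fin m) ℝ).totalDegree ≤ 1 :=
      (totalDegree_sub _ _).trans (by simp)
    omega
  set k := p.totalDegree with hk
  set T : restrictTotalDegree (Fin m) ℝ k →ₗ[ℝ] restrictTotalDegree (Fin m) ℝ k :=
    (polyLaplacian ∘ₗ LinearMap.mulLeft ℝ q).restrict (fun s hs => by
      rw [mem_restrictTotalDegree] at hs ⊢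
      have h1 := totalDegree_polyLaplacian_le (q * s)
      have h2 := totalDegree_mul q s
      simp only [LinearMap.comp_apply, LinearMap.mulLeft_apply]
      omega) with hT
  have hTinj : Function.Injective T := by
    rw [← LinearMap.ker_eq_bot, LinearMap.ker_eq_bot']
    rintro ⟨s, hsk⟩ hs
    have h0 : polyLaplacian (q * s) = 0 := congrArg Subtype.val hs
    have hharm : HarmonicContOnCl (polyFun (q * s)) (ball z R) := by
      refine ⟨fun x _ => ⟨(contDiff_polyFun _).contDiffAt, ?_⟩,
        (contDiff_polyFun _).continuous.continuousOn⟩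
      rw [laplacian_polyFun, h0]
      exact .of_forall fun y => by simp [polyFun]
    refine Subtype.ext (eq_zero_of_polyFun_eq_zero_on_ball (z := z) hR fun x hx => ?_)
    have := eq_of_harmonicContOnCl isBounded_ball isOpen_ball hharm
      (harmonicContOnCl_const (c := (0 : ℝ))) (fun y hy => by
        rw [frontier_ball z hR.ne', mem_sphere] at hy
        rw [hmul, hqx, hy, sub_self, zero_mul]) (subset_closure hx)
    rw [hmul, hqx] at this
    refine (mul_eq_zero.1 this).resolve_left ?_
    have hx' := mem_ball.1 hx
    have : dist x z ^ 2 < R ^ 2 := by gcongr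
    linarith
  obtain ⟨⟨s, hsk⟩, hs⟩ := LinearMap.injective_iff_surjective.1 hTinj
    ⟨polyLaplacian p, by
      rw [mem_restrictTotalDegree]
      exact (totalDegree_polyLaplacian_le p).trans (Nat.sub_le _ _)⟩
  refine ⟨p - q * s, ?_, fun x hx => ?_⟩
  · have : polyLaplacian (q * s) = polyLaplacian p := congrArg Subtype.val hs
    rw [map_sub, this, sub_self]
  · have : polyFun (p - q * s) x = polyFun p x - polyFun (q * s) x := by simp [polyFun]
    rw [this, hmul, hqx, mem_sphere.1 hx]
    ring

/-- The Dirichlet problem is solvable on balls. -/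
theorem exists_harmonicContOnCl_ball (hm : 1 ≤ m) (z : EuclideanSpace ℝ (Fin m)) {R : ℝ}
    (hR : 0 < R) {f : EuclideanSpace ℝ (Fin m) → ℝ} (hf : ContinuousOn f (sphere z R)) :
    ∃ u, HarmonicContOnCl u (ball z R) ∧ ∀ x ∈ sphere z R, u x = f x := by
  have : Nonempty (Fin m) := ⟨⟨0, hm⟩⟩
  rw [← frontier_ball z hR.ne'] at hf ⊢
  refine exists_harmonicContOnCl_of_approx isBounded_ball isOpen_ball fun ε hε => ?_
  rw [frontier_ball z hR.ne'] at hf ⊢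
  obtain ⟨p, hp⟩ := exists_polyFun_near (isCompact_sphere z R) hf hε
  obtain ⟨h, h0, hh⟩ := exists_harmonic_polyFun_eq_on_sphere hm z hR p
  refine ⟨polyFun h, ⟨fun x _ => ⟨(contDiff_polyFun _).contDiffAt, ?_⟩,
    (contDiff_polyFun _).continuous.continuousOn⟩, fun x hx => by
      rw [hh x hx]; exact (hp x hx).le⟩
  rw [laplacian_polyFun, h0]
  exact .of_forall fun y => by simp [polyFun]

end DirichletBall

/-! ### Sweeping out, barriers, and the Dirichlet problem on smooth domains. -/

section Balayage

open Laplacian Set Filter Topology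

variable {m : ℕ}

/-- A domain has a barrier at `p`: a superharmonic function, positive on the closure of the domain
except at `p`, where it vanishes. -/
def HasBarrierAt (Ω : Set (EuclideanSpace ℝ (Fin m))) (p : EuclideanSpace ℝ (Fin m)) : Prop :=
  ∃ b : EuclideanSpace ℝ (Fin m) → ℝ, ContDiff ℝ 2 b ∧ (∀ y ∈ Ω, Δ b y ≤ 0) ∧ b p = 0 ∧
    ∀ y ∈ closure Ω, y ≠ p → 0 < b y

/-- The Poisson modification of a function with the local sub-mean value property. -/
theorem exists_poisson_modification (hm : 1 ≤ m) {Ω : Set (EuclideanSpace ℝ (Fin m))}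
    (hΩ : IsOpen Ω) {v : EuclideanSpace ℝ (Fin m) → ℝ} (hvc : ContinuousOn v (closure Ω))
    (hvs : ∀ x ∈ Ω, SubmeanAt v x) {z : EuclideanSpace ℝ (Fin m)} {R : ℝ} (hR : 0 < R)
    (hball : closedBall z R ⊆ Ω) :
    ∃ v', ContinuousOn v' (closure Ω) ∧ (∀ x ∈ Ω, SubmeanAt v' x) ∧
      (∀ x, v x ≤ v' x) ∧ HarmonicOnNhd v' (ball z R) ∧ ∀ x ∉ ball z R, v' x = v x := by
  classical
  have : Nonempty (Fin m) := ⟨⟨0, hm⟩⟩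
  obtain ⟨u, hu, hus⟩ := exists_harmonicContOnCl_ball hm z hR
    (hvc.mono ((sphere_subset_closedBall.trans hball).trans subset_closure))
  have hcb : closure (ball z R) = closedBall z R := closure_ball z hR.ne'
  have hfb : frontier (ball z R) = sphere z R := frontier_ball z hR.ne'
  have huc : ContinuousOn u (closedBall z R) := hcb ▸ hu.2
  have hle : ∀ x ∈ closedBall z R, v x ≤ u x := by
    intro x hx
    have := le_of_submeanAt (v := fun y => v y + -u y) isBounded_ball isOpen_ball (c := 0)
      ((hvc.mono ((hcb ▸ hball).trans subset_closure)).add hu.2.neg)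
      (fun y hy => (hvs y (hball (ball_subset_closedBall hy))).add isOpen_ball hy
        (submeanAt_of_harmonicOnNhd isOpen_ball hu.neg.1 hy)
        (hvc.mono ((ball_subset_closedBall.trans hball).trans subset_closure))
        hu.neg.1.continuousOn)
      (fun y hy => by rw [hus y (hfb ▸ hy)]; simp) (hcb ▸ hx)
    linarith
  set v' := (ball z R).piecewise u v with hv'
  have hin : ∀ x ∈ closedBall z R, v' x = u x := by
    intro x hx
    by_cases hxb : x ∈ ball z R
    · exact piecewise_eq_of_mem _ _ _ hxb
    · rw [hv', piecewise_eq_of_notMem _ _ _ hxb, hus x]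
      exact le_antisymm (mem_closedBall.1 hx) (not_lt.1 hxb)
  have hout : ∀ x ∉ ball z R, v' x = v x := fun x hx => piecewise_eq_of_notMem _ _ _ hx
  have hvv' : ∀ x, v x ≤ v' x := fun x => by
    by_cases hx : x ∈ ball z R
    · rw [hin x (ball_subset_closedBall hx)]
      exact hle x (ball_subset_closedBall hx)
    · rw [hout x hx]
  have hv'c : ContinuousOn v' (closure Ω) := by
    have h1 : ContinuousOn v' (closedBall z R) := huc.congr hin
    have h2 : ContinuousOn v' (closure Ω \ ball z R) :=
      (hvc.mono sdiff_subset).congr fun x hx => hout x hx.2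
    refine (h1.union_of_isClosed h2 isClosed_closedBall
      (isClosed_closure.sdiff isOpen_ball)).mono fun x hx => ?_
    by_cases hxb : x ∈ ball z R
    · exact Or.inl (ball_subset_closedBall hxb)
    · exact Or.inr ⟨hx, hxb⟩
  have hharm : HarmonicOnNhd v' (ball z R) := fun x hx =>
    (harmonicAt_congr_nhds (Filter.eventuallyEq_iff_exists_mem.2 ⟨_, isOpen_ball.mem_nhds hx,
      fun y hy => hin y (ball_subset_closedBall hy)⟩)).2 (hu.1 x hx)
  refine ⟨v', hv'c, fun x hx => ?_, hvv', hharm, hout⟩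
  by_cases hxb : x ∈ ball z R
  · exact submeanAt_of_harmonicOnNhd isOpen_ball hharm hxb
  -- Outside the ball the value at the centre is unchanged while the averages can only grow.
  · filter_upwards [hvs x hx, eventually_closedBall_subset_of_isOpen hΩ hx] with r h1 h2
    rw [hout x hxb]
    exact h1.trans (average_mono_sphere
      (integrable_comp_sphere (hvc.mono subset_closure) h2.1.le h2.2)
      (integrable_comp_sphere (hv'c.mono subset_closure) h2.1.le h2.2) fun θ => hvv' _)

theorem exists_seq_balls {Ω : Set (EuclideanSpace ℝ (Fin m))} (hΩ : IsOpen Ω) (hne : Ω.Nonempty) :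
    ∃ (z : ℕ → EuclideanSpace ℝ (Fin m)) (R : ℕ → ℝ), (∀ k, 0 < R k) ∧
      (∀ k, closedBall (z k) (R k) ⊆ Ω) ∧ ∀ x ∈ Ω, ∃ k, x ∈ ball (z k) (R k) := by
  have h : ∀ x ∈ Ω, ∃ R > 0, closedBall x R ⊆ Ω := fun x hx =>
    (Metric.nhds_basis_closedBall.mem_iff).1 (hΩ.mem_nhds hx)
  choose! R hR hRΩ using h
  obtain ⟨t, htΩ, htc, htcov⟩ := TopologicalSpace.countable_cover_nhdsWithin
    (f := fun x => ball x (R x)) (s := Ω)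
    fun x hx => mem_nhdsWithin_of_mem_nhds (ball_mem_nhds x (hR x hx))
  have htne : t.Nonempty := by
    obtain ⟨x, hx⟩ := hne
    obtain ⟨y, hy, _⟩ := mem_iUnion₂.1 (htcov hx)
    exact ⟨y, hy⟩
  obtain ⟨z, hz⟩ := htc.exists_eq_range htne
  have hzt : ∀ k, z k ∈ Ω := fun k => htΩ (hz ▸ mem_range_self k)
  refine ⟨z, fun k => R (z k), fun k => hR _ (hzt k), fun k => hRΩ _ (hzt k), fun x hx => ?_⟩
  obtain ⟨y, hy, hxy⟩ := mem_iUnion₂.1 (htcov hx)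
  obtain ⟨k, rfl⟩ : y ∈ range z := hz ▸ hy
  exact ⟨k, hxy⟩

/-- Near p, continuity of F suffices. On the rest of the compact boundary b has a positive minimum,
and a large multiple of b dominates F. -/
theorem exists_barrier_bound {Ω : Set (EuclideanSpace ℝ (Fin m))} (hb : Bornology.IsBounded Ω)
    {F b : EuclideanSpace ℝ (Fin m) → ℝ} (hF : Continuous F) (hbc : Continuous b)
    {p : EuclideanSpace ℝ (Fin m)} (hbp : b p = 0) (hbpos : ∀ y ∈ closure Ω, y ≠ p → 0 < b y)
    {ε : ℝ} (hε : 0 < ε) :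
    ∃ K, 0 ≤ K ∧ ∀ y ∈ frontier Ω, F y ≤ F p + ε + K * b y := by
  obtain ⟨δ, hδ, hball⟩ := Metric.eventually_nhds_iff_ball.1
    ((hF.tendsto p).eventually_lt_const (lt_add_of_pos_right (F p) hε))
  have hfr : IsCompact (frontier Ω) :=
    hb.isCompact_closure.of_isClosed_subset isClosed_frontier frontier_subset_closure
  have hcomp : IsCompact (frontier Ω \ ball p δ) := hfr.diff isOpen_ball
  have hb0 : ∀ y ∈ closure Ω, 0 ≤ b y := fun y hy => by
    by_cases h : y = p
    · rw [h, hbp]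
    · exact (hbpos y hy h).le
  rcases (frontier Ω \ ball p δ).eq_empty_or_nonempty with he | hne
  · refine ⟨0, le_rfl, fun y hy => ?_⟩
    have : y ∈ ball p δ := by
      by_contra h
      exact (he ▸ (⟨hy, h⟩ : y ∈ frontier Ω \ ball p δ) : y ∈ (∅ : Set _))
    linarith [hball y this]
  · obtain ⟨q, hq, hmin⟩ := hcomp.exists_isMinOn hne hbc.continuousOn
    have hqp : 0 < b q := hbpos q (frontier_subset_closure hq.1) fun h =>
      hq.2 (h ▸ mem_ball_self hδ)
    obtain ⟨M, hM⟩ := hfr.exists_bound_of_continuousOn hF.continuousOn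
    have hM0 : 0 ≤ M := (norm_nonneg _).trans (hM q hq.1)
    refine ⟨(M + |F p|) / b q, by positivity, fun y hy => ?_⟩
    by_cases h : y ∈ ball p δ
    · have h1 := hball y h
      have h2 : 0 ≤ (M + |F p|) / b q * b y :=
        mul_nonneg (by positivity) (hb0 y (frontier_subset_closure hy))
      linarith
    · have h1 : b q ≤ b y := hmin ⟨hy, h⟩
      have h2 : (M + |F p|) / b q * b q ≤ (M + |F p|) / b q * b y :=
        mul_le_mul_of_nonneg_left h1 (by positivity)
      rw [div_mul_cancel₀ _ hqp.ne'] at h2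
      have h3 := (le_abs_self _).trans (hM y hy)
      have h4 := neg_abs_le (F p)
      linarith

/-- Solution of the Dirichlet problem with smooth subharmonic data by Poincaré's sweeping out. -/
theorem exists_harmonicContOnCl_of_subharmonic (hm : 1 ≤ m) {Ω : Set (EuclideanSpace ℝ (Fin m))}
    (hΩ : IsOpen Ω) (hne : Ω.Nonempty) (hb : Bornology.IsBounded Ω)
    (hbar : ∀ p ∈ frontier Ω, HasBarrierAt Ω p) {F : EuclideanSpace ℝ (Fin m) → ℝ}
    (hF : ContDiff ℝ 2 F) (hΔ : ∀ x ∈ Ω, 0 ≤ Δ F x) :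
    ∃ u, HarmonicContOnCl u Ω ∧ ∀ x ∈ frontier Ω, u x = F x := by
  have : Nonempty (Fin m) := ⟨⟨0, hm⟩⟩
  obtain ⟨z, R, hR, hball, hcov⟩ := exists_seq_balls hΩ hne
  have hstep : ∀ (j : ℕ) (v : EuclideanSpace ℝ (Fin m) → ℝ), ContinuousOn v (closure Ω) ∧
      (∀ x ∈ Ω, SubmeanAt v x) → ∃ v', (ContinuousOn v' (closure Ω) ∧
      (∀ x ∈ Ω, SubmeanAt v' x)) ∧ (∀ x, v x ≤ v' x) ∧ HarmonicOnNhd v' (ball (z j) (R j)) ∧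
      ∀ x ∉ ball (z j) (R j), v' x = v x := fun j v hv => by
    obtain ⟨v', h1, h2, h3⟩ := exists_poisson_modification hm hΩ hv.1 hv.2 (hR j) (hball j)
    exact ⟨v', ⟨h1, h2⟩, h3⟩
  choose! P hPs hPle hPh hPeq using hstep
  -- The first component of `Nat.unpair` schedules every ball infinitely often.
  set V : ℕ → EuclideanSpace ℝ (Fin m) → ℝ :=
    fun k => Nat.rec F (fun k v => P (Nat.unpair k).1 v) k with hV
  have hV0 : V 0 = F := rfl
  have hVsucc : ∀ k, V (k + 1) = P (Nat.unpair k).1 (V k) := fun k => rfl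
  have hVs : ∀ k, ContinuousOn (V k) (closure Ω) ∧ ∀ x ∈ Ω, SubmeanAt (V k) x := by
    intro k
    induction k with
    | zero => exact ⟨hF.continuous.continuousOn, fun x hx =>
        submeanAt_of_laplacian_nonneg hΩ hF.contDiffOn hΔ hx⟩
    | succ k ih => rw [hVsucc]; exact hPs _ _ ih
  have hVmono : ∀ x, Monotone fun k => V k x := fun x =>
    monotone_nat_of_le_succ fun k => by rw [hVsucc]; exact hPle _ _ (hVs k) x
  have hVfr : ∀ k, ∀ x ∈ frontier Ω, V k x = F x := by
    intro k x hx
    have hxΩ : x ∉ Ω := fun h => (hΩ.inter_frontier_eq ▸ ⟨h, hx⟩ : x ∈ (∅ : Set _))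
    induction k with
    | zero => rfl
    | succ k ih =>
      rw [hVsucc, hPeq _ _ (hVs k) x fun h => hxΩ (hball _ (ball_subset_closedBall h)), ih]
  -- Superharmonic majorants of the boundary data bound all iterates. Constants give convergence,
  -- and barriers give the boundary limits.
  have hupper : ∀ (w : EuclideanSpace ℝ (Fin m) → ℝ), ContDiff ℝ 2 w → (∀ y ∈ Ω, Δ w y ≤ 0) →
      (∀ y ∈ frontier Ω, F y ≤ w y) → ∀ k, ∀ x ∈ closure Ω, V k x ≤ w x := by
    intro w hw hwΔ hwF k x hx
    have := le_of_submeanAt (v := fun y => V k y + (-w) y) hb hΩ (c := 0)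
      ((hVs k).1.add hw.continuous.neg.continuousOn)
      (fun y hy => ((hVs k).2 y hy).add hΩ hy
        (submeanAt_of_laplacian_nonneg hΩ hw.neg.contDiffOn (fun y hy => by
          have hneg : Δ (-w) y = - Δ w y := congrFun (laplacian_neg (f := w)) y
          change 0 ≤ Δ (-w) y
          rw [hneg]
          linarith [hwΔ y hy]) hy)
        ((hVs k).1.mono subset_closure) hw.continuous.neg.continuousOn)
      (fun y hy => by
        have := hwF y hy
        rw [hVfr k y hy, Pi.neg_apply]
        linarith) hx
    rw [Pi.neg_apply] at this
    linarith
  obtain ⟨M, hM⟩ := hb.isCompact_closure.exists_bound_of_continuousOn hF.continuous.continuousOn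
  have hVM : ∀ k, ∀ x ∈ closure Ω, V k x ≤ M := hupper (fun _ => M) contDiff_const
    (fun y _ => by simp [laplacian_const])
    fun y hy => (le_abs_self _).trans (hM y (frontier_subset_closure hy))
  have hFV : ∀ k x, F x ≤ V k x := fun k x => hVmono x (Nat.zero_le k)
  set u : EuclideanSpace ℝ (Fin m) → ℝ := fun x => ⨆ k, V k x with hu
  have hlim : ∀ x ∈ closure Ω, Tendsto (fun k => V k x) atTop (𝓝 (u x)) := fun x hx =>
    tendsto_atTop_ciSup (hVmono x) ⟨M, by rintro _ ⟨k, rfl⟩; exact hVM k x hx⟩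
  have hFu : ∀ x ∈ closure Ω, F x ≤ u x := fun x hx => ge_of_tendsto' (hlim x hx) fun k => hFV k x
  have huF : ∀ x ∈ frontier Ω, u x = F x := fun x hx => by simp [hu, hVfr _ x hx]
  have hharm : HarmonicOnNhd u Ω := by
    intro x hx
    obtain ⟨j, hj⟩ := hcov x hx
    have hjΩ : ball (z j) (R j) ⊆ Ω := ball_subset_closedBall.trans (hball j)
    -- Along the steps that sweep the j-th ball, the iterates are harmonic in that ball.
    refine harmonicOnNhd_of_tendsto (U := ball (z j) (R j)) isOpen_ball
      (u := fun n => V (Nat.pair j n + 1)) (M := M) (fun n => ?_) (fun n y hy => ?_)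
      (fun y hy => ?_) x hj
    · have := hPh j (V (Nat.pair j n)) (hVs _)
      simpa only [hVsucc, Nat.unpair_pair] using this
    · have hy' := subset_closure (hjΩ hy)
      exact abs_le.2 ⟨(abs_le.1 (hM y hy')).1.trans (hFV (Nat.pair j n + 1) y),
        hVM (Nat.pair j n + 1) y hy'⟩
    · refine (hlim y (subset_closure (hjΩ hy))).comp ((tendsto_add_atTop_nat 1).comp ?_)
      exact tendsto_atTop_mono (fun n => Nat.right_le_pair j n) tendsto_id
  refine ⟨u, ⟨hharm, fun x hx => ?_⟩, huF⟩
  by_cases hxΩ : x ∈ Ω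
  · exact (hharm x hxΩ).1.continuousAt.continuousWithinAt
  have hxf : x ∈ frontier Ω := ⟨hx, by rwa [hΩ.interior_eq]⟩
  obtain ⟨b, hbc, hbΔ, hbx, hbpos⟩ := hbar x hxf
  rw [ContinuousWithinAt, huF x hxf, tendsto_order]
  refine ⟨fun a ha => ?_, fun a ha => ?_⟩
  · filter_upwards [self_mem_nhdsWithin, mem_nhdsWithin_of_mem_nhds
      ((hF.continuous.tendsto x).eventually_const_lt ha)] with y hy h1
    exact lt_of_lt_of_le h1 (hFu y hy)
  · set ε := (a - F x) / 2 with hε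
    have hε0 : 0 < ε := by rw [hε]; linarith
    obtain ⟨K, hK0, hK⟩ := exists_barrier_bound hb hF.continuous hbc.continuous hbx hbpos hε0
    have hle : ∀ y ∈ closure Ω, u y ≤ F x + ε + K * b y := by
      intro y hy
      refine le_of_tendsto' (hlim y hy) fun k => ?_
      refine hupper (fun y => F x + ε + K * b y) (contDiff_const.add (contDiff_const.mul hbc))
        (fun y hy => ?_) hK k y hy
      have h1 : Δ ((fun _ : EuclideanSpace ℝ (Fin m) => F x + ε) + K • b) y = K * Δ b y := by
        have hKb : ContDiffAt ℝ 2 (K • b) y := (hbc.const_smul K).contDiffAt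
        rw [ContDiffAt.laplacian_add contDiffAt_const hKb,
          laplacian_smul _ hbc.contDiffAt]
        simp [laplacian_const]
      refine (h1.le.trans ?_)
      exact mul_nonpos_of_nonneg_of_nonpos hK0 (hbΔ y hy)
    have hcont : Continuous fun y => F x + ε + K * b y := by
      have := hbc.continuous
      fun_prop
    have hlt : F x + ε + K * b x < a := by
      rw [hbx, mul_zero, add_zero, hε]
      linarith
    filter_upwards [self_mem_nhdsWithin, mem_nhdsWithin_of_mem_nhds
      ((hcont.tendsto x).eventually_lt_const hlt)] with y hy h1
    exact lt_of_le_of_lt (hle y hy) h1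

/-- Solution of the Dirichlet problem on a bounded open set with barriers. -/
theorem exists_harmonicContOnCl_of_hasBarrierAt (hm : 1 ≤ m)
    {Ω : Set (EuclideanSpace ℝ (Fin m))}
    (hΩ : IsOpen Ω) (hne : Ω.Nonempty) (hb : Bornology.IsBounded Ω)
    (hbar : ∀ p ∈ frontier Ω, HasBarrierAt Ω p) {f : EuclideanSpace ℝ (Fin m) → ℝ}
    (hf : ContinuousOn f (frontier Ω)) :
    ∃ u, HarmonicContOnCl u Ω ∧ ∀ x ∈ frontier Ω, u x = f x := by
  have : Nonempty (Fin m) := ⟨⟨0, hm⟩⟩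
  have hfr : IsCompact (frontier Ω) :=
    hb.isCompact_closure.of_isClosed_subset isClosed_frontier frontier_subset_closure
  refine exists_harmonicContOnCl_of_approx hb hΩ fun ε hε => ?_
  obtain ⟨p, hp⟩ := exists_polyFun_near hfr hf hε
  obtain ⟨C, hC⟩ := hb.isCompact_closure.exists_bound_of_continuousOn
    (contDiff_polyFun (polyLaplacian p)).continuous.continuousOn
  have hC0 : 0 ≤ C := by
    obtain ⟨x, hx⟩ := hne
    exact (norm_nonneg _).trans (hC x (subset_closure hx))
  -- With C a bound for |Δp|, both p + C q and C q are subharmonic because ΔCq = 2mC; the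
  -- approximating data p are their difference.
  set q : EuclideanSpace ℝ (Fin m) → ℝ := fun x => ‖x - 0‖ ^ 2 with hq
  have hqc : ContDiff ℝ 2 q := (contDiff_norm_sq ℝ).comp (contDiff_id.sub contDiff_const)
  have hqs : ContDiff ℝ 2 (C • q) := contDiff_const.smul hqc
  have hqΔ : ∀ x, Δ (C • q) x = C * (2 * m) := fun x => by
    rw [laplacian_smul _ hqc.contDiffAt, hq, laplacian_norm_sub_sq, finrank_euclideanSpace_fin,
      smul_eq_mul]
  obtain ⟨u₁, hu₁, hu₁f⟩ := exists_harmonicContOnCl_of_subharmonic hm hΩ hne hb hbar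
    ((contDiff_polyFun p).add hqs) fun x hx => by
      have h1 : Δ (polyFun p + C • q) x = polyFun (polyLaplacian p) x + C * (2 * m) := by
        rw [(contDiff_polyFun p).contDiffAt.laplacian_add hqs.contDiffAt, hqΔ, laplacian_polyFun]
      refine le_of_le_of_eq ?_ h1.symm
      have h2 := (abs_le.1 (hC x (subset_closure hx))).1
      have h3 : (1 : ℝ) ≤ m := by exact_mod_cast hm
      nlinarith
  obtain ⟨u₂, hu₂, hu₂f⟩ := exists_harmonicContOnCl_of_subharmonic hm hΩ hne hb hbar
    hqs fun x hx => by rw [hqΔ]; positivity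
  refine ⟨u₁ - u₂, hu₁.sub hu₂, fun x hx => ?_⟩
  have h1 := hu₁f x hx
  have h2 := hu₂f x hx
  rw [Pi.sub_apply, h1, h2]
  simpa using (hp x hx).le

/-- The barrier is exp(-α r²) - exp(-α|y - c|²). Writing t = |y - c|², its Laplacian is -2α exp(-α
t)(2αt - m). Since t ≥ r² on the closure, α = m / r² + 1 makes it nonpositive. -/
theorem HasBarrierAt.of_exterior_ball {Ω : Set (EuclideanSpace ℝ (Fin m))}
    {p c : EuclideanSpace ℝ (Fin m)} {r : ℝ} (hr : 0 < r) (hp : dist p c = r)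
    (h : ∀ y ∈ closure Ω, y ≠ p → r < dist y c) : HasBarrierAt Ω p := by
  set α := (m : ℝ) / r ^ 2 + 1 with hα
  have hα0 : 0 < α := by positivity
  set g : ℝ → ℝ := fun t => -Real.exp (-α * t) with hg
  set g' : ℝ → ℝ := fun t => α * Real.exp (-α * t) with hg'
  set g'' : ℝ → ℝ := fun t => -(α ^ 2 * Real.exp (-α * t)) with hg''
  have hexp : ∀ t, HasDerivAt (fun t => Real.exp (-α * t)) (Real.exp (-α * t) * -α) t := fun t => by
    simpa using ((hasDerivAt_id t).const_mul (-α)).exp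
  have h1 : ∀ t, HasDerivAt g (g' t) t := fun t =>
    (hexp t).neg.congr_deriv (by simp only [hg']; ring)
  have h2 : ∀ t, HasDerivAt g' (g'' t) t := fun t =>
    ((hexp t).const_mul α).congr_deriv (by simp only [hg'']; ring)
  have hgc : ContDiff ℝ 2 g := (Real.contDiff_exp.comp (contDiff_const.mul contDiff_id)).neg
  have hqc : ContDiff ℝ 2 fun y : EuclideanSpace ℝ (Fin m) => g (‖y - c‖ ^ 2) :=
    hgc.comp ((contDiff_norm_sq ℝ).comp (contDiff_id.sub contDiff_const))
  have hΩr : ∀ y ∈ closure Ω, r ≤ dist y c := fun y hy => by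
    by_cases hyp : y = p
    · rw [hyp, hp]
    · exact (h y hy hyp).le
  refine ⟨fun y => Real.exp (-α * r ^ 2) + g (‖y - c‖ ^ 2), contDiff_const.add hqc,
    fun y hy => ?_, ?_, fun y hy hyp => ?_⟩
  · have hadd : Δ ((fun _ : EuclideanSpace ℝ (Fin m) => Real.exp (-α * r ^ 2)) +
        fun y => g (‖y - c‖ ^ 2)) y = Δ (fun y => g (‖y - c‖ ^ 2)) y := by
      rw [ContDiffAt.laplacian_add contDiffAt_const hqc.contDiffAt]
      simp [laplacian_const]
    refine hadd.le.trans ?_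
    rw [laplacian_comp_norm_sub_sq h1 h2 hgc, finrank_euclideanSpace_fin]
    have h3 : r ^ 2 ≤ ‖y - c‖ ^ 2 := by
      have := hΩr y (subset_closure hy)
      rw [dist_eq_norm] at this
      gcongr
    set t := ‖y - c‖ ^ 2 with ht
    have h4 : (m : ℝ) ≤ t * α := by
      calc (m : ℝ) = r ^ 2 * (m / r ^ 2) := by field_simp
        _ ≤ t * α := by
          refine mul_le_mul h3 (by rw [hα]; linarith) (by positivity) (by positivity)
    have h5 : 4 * t * g'' t + 2 * m * g' t =
        -(2 * α * Real.exp (-α * t) * (2 * (t * α) - m)) := by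
      simp only [hg', hg'']; ring
    rw [h5, neg_nonpos]
    have : (0 : ℝ) ≤ m := by positivity
    exact mul_nonneg (by positivity) (by linarith)
  · rw [dist_eq_norm] at hp
    simp only [hp, hg]
    ring
  · have h3 : r ^ 2 < ‖y - c‖ ^ 2 := by
      have := h y hy hyp
      rw [dist_eq_norm] at this
      gcongr
    simp only [hg]
    have : Real.exp (-α * ‖y - c‖ ^ 2) < Real.exp (-α * r ^ 2) :=
      Real.exp_lt_exp.2 (by nlinarith)
    linarith

/-- Second-order Taylor estimate for a twice continuously differentiable function. -/
theorem exists_abs_sub_fderiv_le {ρ : EuclideanSpace ℝ (Fin m) → ℝ}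
    {p : EuclideanSpace ℝ (Fin m)} (hρ : ContDiffAt ℝ 2 ρ p) :
    ∃ C > 0, ∃ δ > 0, ∀ y ∈ ball p δ, |ρ y - ρ p - fderiv ℝ ρ p (y - p)| ≤ C * ‖y - p‖ ^ 2 := by
  have h1 : ContDiffAt ℝ 1 (fderiv ℝ ρ) p := hρ.fderiv_right (by norm_num)
  obtain ⟨K, t, ht, hK⟩ := h1.exists_lipschitzOnWith
  have h2 : ∀ᶠ y in 𝓝 p, DifferentiableAt ℝ ρ y :=
    (hρ.eventually (by norm_num)).mono fun y hy => hy.differentiableAt (by norm_num)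
  obtain ⟨δ, hδ, hsub⟩ := Metric.eventually_nhds_iff_ball.1 (h2.and ht)
  refine ⟨K + 1, by positivity, δ, hδ, fun y hy => ?_⟩
  have hcb : closedBall p ‖y - p‖ ⊆ ball p δ :=
    closedBall_subset_ball (by rwa [mem_ball, dist_eq_norm] at hy)
  have hpt : p ∈ t := (hsub p (mem_ball_self hδ)).2
  have := (convex_closedBall p ‖y - p‖).norm_image_sub_le_of_norm_hasFDerivWithin_le
    (f := fun z => ρ z - fderiv ℝ ρ p z) (f' := fun z => fderiv ℝ ρ z - fderiv ℝ ρ p)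
    (C := K * ‖y - p‖) (x := p) (y := y)
    (fun z hz => ((hsub z (hcb hz)).1.hasFDerivAt.sub
      (fderiv ℝ ρ p).hasFDerivAt).hasFDerivWithinAt)
    (fun z hz => by
      have h3 := hK.dist_le_mul z (hsub z (hcb hz)).2 p hpt
      rw [dist_eq_norm] at h3
      refine h3.trans ?_
      gcongr
      exact hz)
    (mem_closedBall_self (norm_nonneg _)) (by simp [dist_eq_norm])
  rw [Real.norm_eq_abs] at this
  have heq : ρ y - ρ p - fderiv ℝ ρ p (y - p) =
      ρ y - fderiv ℝ ρ p y - (ρ p - fderiv ℝ ρ p p) := by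
    rw [map_sub]; ring
  rw [heq]
  refine this.trans ?_
  nlinarith [sq_nonneg ‖y - p‖]

/-- Place a ball of small radius r with centre p + rν, where ν is the unit vector along g = ∇ρ(p). A
point y of that closed ball satisfies |y - p|² ≤ 2r⟨y - p, ν⟩. The Taylor estimate then gives ρ(y) ≥
(|g| - 2Cr)⟨y - p, ν⟩ > 0 unless y = p, while ρ ≤ 0 on the closure of Ω near p. -/
theorem IsSmoothlyBoundedDomain.hasBarrierAt {Ω : Set (EuclideanSpace ℝ (Fin m))}
    (hΩ : IsSmoothlyBoundedDomain Ω) {p : EuclideanSpace ℝ (Fin m)} (hp : p ∈ frontier Ω) :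
    HasBarrierAt Ω p := by
  obtain ⟨U, ρ, hU, hpU, hρ, hd, hΩU⟩ := hΩ.smooth_boundary p hp
  have hUp : U ∈ 𝓝 p := hU.mem_nhds hpU
  have hle : ∀ y ∈ closure Ω ∩ U, ρ y ≤ 0 := by
    rintro y ⟨hy, hyU⟩
    have hyc : ContinuousAt ρ y := hρ.continuousOn.continuousAt (hU.mem_nhds hyU)
    by_contra! hpos
    obtain ⟨z, hzU, hzΩ⟩ := mem_closure_iff_nhds.1 hy _
      (Filter.inter_mem (hyc.eventually_const_lt hpos) (hU.mem_nhds hyU))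
    have : z ∈ {y ∈ U | ρ y < 0} := hΩU ▸ ⟨hzΩ, hzU.2⟩
    exact lt_asymm this.2 hzU.1
  have hp0 : 0 ≤ ρ p := by
    by_contra! h
    have h1 : p ∈ Ω ∩ U := hΩU ▸ ⟨hpU, h⟩
    have h2 : p ∈ Ω ∩ frontier Ω := ⟨h1.1, hp⟩
    rw [hΩ.isOpen.inter_frontier_eq] at h2
    exact h2
  obtain ⟨C, hC, δ, hδ, hT⟩ := exists_abs_sub_fderiv_le
    ((hρ.contDiffAt hUp).of_le (WithTop.coe_le_coe.2 (le_top : (2 : ℕ∞) ≤ ⊤)))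
  obtain ⟨δ', hδ', hδU⟩ := Metric.mem_nhds_iff.1 hUp
  set g := (toDual ℝ (EuclideanSpace ℝ (Fin m))).symm (fderiv ℝ ρ p) with hg
  have hgd : ∀ v, fderiv ℝ ρ p v = inner ℝ g v := fun v => by
    rw [hg, toDual_symm_apply]
  have hg0 : 0 < ‖g‖ := by
    rw [norm_pos_iff, hg]
    simpa using hd
  -- Points of the ball are within 2r of p, hence inside U and the Taylor neighbourhood; the last
  -- bound gives 2Cr ≤ |g| / 2.
  set r := min (min (δ / 4) (δ' / 4)) (‖g‖ / (4 * C)) with hr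
  have hr0 : 0 < r := by positivity
  have hrδ : r ≤ δ / 4 := (min_le_left _ _).trans (min_le_left _ _)
  have hrδ' : r ≤ δ' / 4 := (min_le_left _ _).trans (min_le_right _ _)
  have hrg : r * (4 * C) ≤ ‖g‖ := (le_div_iff₀ (by positivity)).1 (min_le_right _ _)
  set ν := ‖g‖⁻¹ • g with hν
  have hν1 : ‖ν‖ = 1 := by simp [hν, norm_smul, hg0.ne']
  refine HasBarrierAt.of_exterior_ball hr0 (c := p + r • ν)
    (by simp [norm_smul, hν1, abs_of_pos hr0]) fun y hy hyp => ?_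
  by_contra! hyr
  have hyp0 : 0 < ‖y - p‖ := norm_pos_iff.2 (sub_ne_zero.2 hyp)
  have hyp2 : ‖y - p‖ ≤ 2 * r := by
    rw [← dist_eq_norm]
    calc dist y p ≤ dist y (p + r • ν) + dist (p + r • ν) p := dist_triangle _ _ _
      _ ≤ r + r := add_le_add hyr (by simp [norm_smul, hν1, abs_of_pos hr0])
      _ = 2 * r := by ring
  have hyU : y ∈ U := hδU (by rw [mem_ball, dist_eq_norm]; linarith)
  have hyT := (abs_le.1 (hT y (by rw [mem_ball, dist_eq_norm]; linarith))).1
  have hρy := hle y ⟨hy, hyU⟩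
  have hin : ‖y - p‖ ^ 2 ≤ 2 * r * inner ℝ (y - p) ν := by
    have h1 : ‖(y - p) - r • ν‖ ^ 2 ≤ r ^ 2 := by
      rw [dist_eq_norm, ← sub_sub] at hyr
      gcongr
    rw [norm_sub_sq_real, inner_smul_right, norm_smul, hν1, Real.norm_eq_abs, mul_one, sq_abs] at h1
    linarith
  have hgin : fderiv ℝ ρ p (y - p) = ‖g‖ * inner ℝ (y - p) ν := by
    rw [hgd, hν, inner_smul_right, real_inner_comm]
    field_simp
  rw [hgin] at hyT
  have hs : 0 < ‖y - p‖ ^ 2 := by positivity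
  have hipos : 0 < inner ℝ (y - p) ν := by
    by_contra! h
    nlinarith
  have h6 : r * (4 * C) * inner ℝ (y - p) ν ≤ ‖g‖ * inner ℝ (y - p) ν :=
    mul_le_mul_of_nonneg_right hrg hipos.le
  have h7 : C * ‖y - p‖ ^ 2 ≤ C * (2 * r * inner ℝ (y - p) ν) := mul_le_mul_of_nonneg_left hin hC.le
  have h8 : 0 < C * r * inner ℝ (y - p) ν := by positivity
  nlinarith

/-- The Dirichlet problem is solvable on a smoothly bounded domain. -/
theorem IsSmoothlyBoundedDomain.exists_harmonicContOnCl (hm : 1 ≤ m)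
    {Ω : Set (EuclideanSpace ℝ (Fin m))} (hΩ : IsSmoothlyBoundedDomain Ω)
    {f : EuclideanSpace ℝ (Fin m) → ℝ} (hf : ContinuousOn f (frontier Ω)) :
    ∃ u, HarmonicContOnCl u Ω ∧ ∀ x ∈ frontier Ω, u x = f x :=
  exists_harmonicContOnCl_of_hasBarrierAt hm hΩ.isOpen hΩ.isConnected.nonempty hΩ.isBounded
    (fun _ hp => hΩ.hasBarrierAt hp) hf

end Balayage

/-! ### Existence of harmonic measure. -/

section HarmonicMeasureExistence

open Set CompactlySupported

variable {m : ℕ} {Ω : Set (EuclideanSpace ℝ (Fin m))}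

theorem IsSmoothlyBoundedDomain.isCompact_frontier (hΩ : IsSmoothlyBoundedDomain Ω) :
    IsCompact (frontier Ω) :=
  hΩ.isBounded.isCompact_closure.of_isClosed_subset isClosed_frontier frontier_subset_closure

theorem IsSmoothlyBoundedDomain.exists_dirichlet (hm : 1 ≤ m) (hΩ : IsSmoothlyBoundedDomain Ω)
    (f : C(frontier Ω, ℝ)) :
    ∃ u, HarmonicContOnCl u Ω ∧ ∀ τ : frontier Ω, u τ = f τ := by
  classical
  set g : EuclideanSpace ℝ (Fin m) → ℝ := fun x => if h : x ∈ frontier Ω then f ⟨x, h⟩ else 0 with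
    hg
  have hgf : ∀ τ : frontier Ω, g τ = f τ := fun τ => by simp [hg]
  have hgc : ContinuousOn g (frontier Ω) := by
    rw [continuousOn_iff_continuous_domRestrict]
    exact f.continuous.congr fun τ => (hgf τ).symm
  obtain ⟨u, hu, huf⟩ := hΩ.exists_harmonicContOnCl hm hgc
  exact ⟨u, hu, fun τ => (huf τ τ.2).trans (hgf τ)⟩

/-- Evaluating at x the solution with data f is linear in f by uniqueness and positive by the
maximum principle, so the Riesz–Markov theorem represents it. The solution with data 1 is constant,
which gives total mass 1. -/
theorem IsSmoothlyBoundedDomain.exists_isHarmonicMeasure (hm : 1 ≤ m)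
    (hΩ : IsSmoothlyBoundedDomain Ω) {x : EuclideanSpace ℝ (Fin m)} (hx : x ∈ Ω) :
    ∃ μ : Measure (frontier Ω), IsHarmonicMeasure Ω x μ := by
  have : Nonempty (Fin m) := ⟨⟨0, hm⟩⟩
  have : CompactSpace (frontier Ω) := isCompact_iff_compactSpace.1 hΩ.isCompact_frontier
  choose S hS hSf using fun f => hΩ.exists_dirichlet hm f
  have huniq : ∀ (f : C(frontier Ω, ℝ)) (u : EuclideanSpace ℝ (Fin m) → ℝ), HarmonicContOnCl u Ω →
      (∀ τ : frontier Ω, u τ = f τ) → S f x = u x := fun f u hu huf =>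
    eq_of_harmonicContOnCl hΩ.isBounded hΩ.isOpen (hS f) hu
      (fun y hy => (hSf f ⟨y, hy⟩).trans (huf ⟨y, hy⟩).symm) (subset_closure hx)
  let Λ : C_c(frontier Ω, ℝ) →ₚ[ℝ] ℝ := PositiveLinearMap.mk₀
    { toFun := fun f => S f.toContinuousMap x
      map_add' := fun f g => huniq _ _ ((hS f.toContinuousMap).add (hS g.toContinuousMap))
        fun τ => by simp [hSf]
      map_smul' := fun c f => huniq _ _ ((hS f.toContinuousMap).const_smul c)
        fun τ => by simp [hSf] }
    (fun f hf => by
      have := le_of_submeanAt hΩ.isBounded hΩ.isOpen (hS f.toContinuousMap).neg.2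
        (fun y hy => submeanAt_of_harmonicOnNhd hΩ.isOpen (hS f.toContinuousMap).neg.1 hy)
        (c := 0) (fun y hy => by
          have h1 := hSf f.toContinuousMap ⟨y, hy⟩
          have h2 : 0 ≤ f ⟨y, hy⟩ := hf ⟨y, hy⟩
          simp only [Pi.neg_apply, h1]
          simpa using h2) (subset_closure hx)
      simpa using this)
  have hint : ∀ f : C(frontier Ω, ℝ), ∫ τ, f τ ∂(RealRMK.rieszMeasure Λ) = S f x := fun f =>
    RealRMK.integral_rieszMeasure Λ (CompactlySupportedContinuousMap.continuousMapEquiv f)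
  refine ⟨RealRMK.rieszMeasure Λ, ⟨?_⟩, fun f => ⟨S f, hS f, hSf f, (hint f).symm⟩⟩
  have h1 := hint 1
  rw [huniq 1 (fun _ => 1) harmonicContOnCl_const fun τ => rfl] at h1
  simp only [ContinuousMap.one_apply, integral_const, smul_eq_mul, mul_one] at h1
  rw [← ENNReal.toReal_eq_one_iff]
  exact h1

theorem IsSmoothlyBoundedDomain.isHarmonicMeasure_harmonicMeasure (hm : 1 ≤ m)
    (hΩ : IsSmoothlyBoundedDomain Ω) {x : EuclideanSpace ℝ (Fin m)} (hx : x ∈ Ω) :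
    IsHarmonicMeasure Ω x (harmonicMeasure Ω x) := by
  have h := hΩ.exists_isHarmonicMeasure hm hx
  rw [harmonicMeasure, dif_pos h]
  exact h.choose_spec

/-- `IsHarmonicMeasure` provides a solution depending on x; uniqueness identifies all of them with a
single one. -/
theorem IsSmoothlyBoundedDomain.harmonicOnNhd_integral_harmonicMeasure (hm : 1 ≤ m)
    (hΩ : IsSmoothlyBoundedDomain Ω) (f : C(frontier Ω, ℝ)) :
    HarmonicOnNhd (fun x => ∫ τ, f τ ∂(harmonicMeasure Ω x)) Ω := by
  have : Nonempty (Fin m) := ⟨⟨0, hm⟩⟩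
  obtain ⟨u, hu, huf⟩ := hΩ.exists_dirichlet hm f
  have heq : ∀ x ∈ Ω, ∫ τ, f τ ∂(harmonicMeasure Ω x) = u x := by
    intro x hx
    obtain ⟨w, hw, hwf, hwx⟩ := (hΩ.isHarmonicMeasure_harmonicMeasure hm hx).2 f
    rw [← hwx]
    exact eq_of_harmonicContOnCl hΩ.isBounded hΩ.isOpen hw hu
      (fun y hy => (hwf ⟨y, hy⟩).trans (huf ⟨y, hy⟩).symm) (subset_closure hx)
  intro x hx
  exact (harmonicAt_congr_nhds (Filter.eventuallyEq_iff_exists_mem.2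
    ⟨Ω, hΩ.isOpen.mem_nhds hx, heq⟩)).2 (hu.1 x hx)

end HarmonicMeasureExistence

/-! ### The Prékopa–Leindler inequality. -/

section PrekopaLeindler

open Set NNReal ENNReal Pointwise

theorem ENNReal.geom_mean_le_arith_mean2_weighted {s t : ℝ≥0} (hs : s ≠ 0) (ht : t ≠ 0)
    (hst : s + t = 1) (a b : ℝ≥0∞) : a ^ (s : ℝ) * b ^ (t : ℝ) ≤ s * a + t * b := by
  rcases eq_or_ne a ⊤ with rfl | ha
  · simp [ENNReal.mul_top, hs]
  rcases eq_or_ne b ⊤ with rfl | hb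
  · simp [ENNReal.mul_top, ht]
  lift a to ℝ≥0 using ha
  lift b to ℝ≥0 using hb
  rw [← ENNReal.coe_rpow_of_nonneg a s.coe_nonneg, ← ENNReal.coe_rpow_of_nonneg b t.coe_nonneg]
  exact_mod_cast NNReal.geom_mean_le_arith_mean2_weighted s t a b hst

/-- The one-dimensional sum inequality fails for empty sets, so inner regularity is stated with
nonempty compact sets. -/
theorem MeasurableSet.measure_eq_iSup_isCompact_nonempty {A : Set ℝ} (hA : MeasurableSet A)
    (hne : A.Nonempty) :
    volume A = ⨆ K : {K : Set ℝ // K ⊆ A ∧ IsCompact K ∧ K.Nonempty}, volume (K : Set ℝ) := by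
  obtain ⟨a, ha⟩ := hne
  refine le_antisymm ?_ (iSup_le fun K => measure_mono K.2.1)
  rw [hA.measure_eq_iSup_isCompact]
  refine iSup_le fun K => iSup₂_le fun hKA hK => ?_
  exact (measure_mono (subset_insert a K)).trans (le_iSup (fun K : {K : Set ℝ // K ⊆ A ∧
    IsCompact K ∧ K.Nonempty} => volume (K : Set ℝ))
      ⟨insert a K, insert_subset ha hKA, hK.insert a, insert_nonempty _ _⟩)

/-- With a₁ = max K and b₀ = min L, the translates sK + tb₀ and sa₁ + tL both lie in C. The first is
to the left of p = sa₁ + tb₀ and the second to its right, so their volumes add. -/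
theorem IsCompact.add_volume_le_volume {s t : ℝ≥0} {K L C : Set ℝ} (hK : IsCompact K)
    (hL : IsCompact L) (hKne : K.Nonempty) (hLne : L.Nonempty)
    (h : ∀ a ∈ K, ∀ b ∈ L, (s : ℝ) * a + t * b ∈ C) :
    s * volume K + t * volume L ≤ volume C := by
  have hvol : ∀ (c : ℝ≥0) (v : ℝ) (S : Set ℝ), volume (v +ᵥ ((c : ℝ) • S)) = c * volume S := by
    intro c v S
    rw [measure_vadd, Measure.addHaar_smul]
    simp
  have hcomp : ∀ (c : ℝ≥0) (v : ℝ) {S : Set ℝ}, IsCompact S → IsCompact (v +ᵥ ((c : ℝ) • S)) :=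
    fun c v S hS => (hS.smul _).vadd _
  obtain ⟨a₁, ha₁, hmax⟩ := hK.exists_isGreatest hKne
  obtain ⟨b₀, hb₀, hmin⟩ := hL.exists_isLeast hLne
  set S₁ := (t * b₀ : ℝ) +ᵥ ((s : ℝ) • K) with hS₁
  set S₂ := (s * a₁ : ℝ) +ᵥ ((t : ℝ) • L) with hS₂
  set p : ℝ := s * a₁ + t * b₀ with hp
  have h1 : ∀ x ∈ S₁, x ∈ C ∧ x ≤ p := by
    rintro _ ⟨_, ⟨a, ha, rfl⟩, rfl⟩
    simp only [vadd_eq_add, smul_eq_mul]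
    refine ⟨by rw [add_comm]; exact h a ha b₀ hb₀, ?_⟩
    have := mul_le_mul_of_nonneg_left (hmax ha) s.2
    change (s : ℝ) * a ≤ s * a₁ at this
    linarith
  have h2 : ∀ x ∈ S₂, x ∈ C ∧ p ≤ x := by
    rintro _ ⟨_, ⟨b, hb, rfl⟩, rfl⟩
    simp only [vadd_eq_add, smul_eq_mul]
    refine ⟨h a₁ ha₁ b hb, ?_⟩
    have := mul_le_mul_of_nonneg_left (hmin hb) t.2
    change (t : ℝ) * b₀ ≤ t * b at this
    linarith
  have hdisj : Disjoint (S₁ \ {p}) S₂ := by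
    rw [Set.disjoint_left]
    rintro x ⟨hx1, hxp⟩ hx2
    exact hxp (le_antisymm (h1 x hx1).2 (h2 x hx2).2)
  calc s * volume K + t * volume L = volume (S₁ \ {p}) + volume S₂ := by
        rw [measure_sdiff_null (measure_singleton p), hvol, hvol]
    _ = volume (S₁ \ {p} ∪ S₂) :=
        (measure_union hdisj (hcomp t _ hL).measurableSet).symm
    _ ≤ volume C := measure_mono (union_subset (fun x hx => (h1 x hx.1).1) fun x hx => (h2 x hx).1)

/-- The one-dimensional Brunn–Minkowski inequality. -/
theorem add_volume_le_volume_of_nonempty {s t : ℝ≥0} {A B C : Set ℝ} (hA : MeasurableSet A)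
    (hB : MeasurableSet B) (hAne : A.Nonempty) (hBne : B.Nonempty)
    (h : ∀ a ∈ A, ∀ b ∈ B, (s : ℝ) * a + t * b ∈ C) :
    s * volume A + t * volume B ≤ volume C := by
  rw [hA.measure_eq_iSup_isCompact_nonempty hAne, hB.measure_eq_iSup_isCompact_nonempty hBne,
    ENNReal.mul_iSup, ENNReal.mul_iSup]
  obtain ⟨a, ha⟩ := hAne
  obtain ⟨b, hb⟩ := hBne
  have : Nonempty {K : Set ℝ // K ⊆ A ∧ IsCompact K ∧ K.Nonempty} :=
    ⟨⟨{a}, singleton_subset_iff.2 ha, isCompact_singleton, singleton_nonempty a⟩⟩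
  have : Nonempty {K : Set ℝ // K ⊆ B ∧ IsCompact K ∧ K.Nonempty} :=
    ⟨⟨{b}, singleton_subset_iff.2 hb, isCompact_singleton, singleton_nonempty b⟩⟩
  rw [ENNReal.iSup_add]
  refine iSup_le fun K => ?_
  rw [ENNReal.add_iSup]
  exact iSup_le fun L => K.2.2.1.add_volume_le_volume L.2.2.1 K.2.2.2 L.2.2.2
    fun a ha b hb => h a (K.2.1 ha) b (L.2.1 hb)

theorem lintegral_eq_lintegral_Ioo_of_le_one {f : ℝ → ℝ≥0∞} (hf : Measurable f)
    (hf1 : ∀ x, f x ≤ 1) :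
    ∫⁻ x, f x = ∫⁻ c in Ioo (0 : ℝ) 1, volume {x | ENNReal.ofReal c < f x} := by
  have htop : ∀ x, f x ≠ ⊤ := fun x => ((hf1 x).trans_lt one_lt_top).ne
  have h1 : ∫⁻ x, f x = ∫⁻ c in Ioi (0 : ℝ), volume {x | c < (f x).toReal} := by
    rw [← lintegral_eq_lintegral_meas_lt volume (.of_forall fun x => toReal_nonneg)
      hf.ennreal_toReal.aemeasurable]
    simp only [ENNReal.ofReal_toReal (htop _)]
  have h2 : ∀ c ∈ Ioi (0 : ℝ), volume {x | c < (f x).toReal} =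
      (Ioo (0 : ℝ) 1).indicator (fun c => volume {x | ENNReal.ofReal c < f x}) c := by
    intro c hc
    by_cases hc1 : c < 1
    · have hmem : c ∈ Ioo (0 : ℝ) 1 := ⟨hc, hc1⟩
      rw [Set.indicator_of_mem hmem]
      congr 1
      ext x
      exact (ENNReal.ofReal_lt_iff_lt_toReal hc.out.le (htop x)).symm
    · rw [Set.indicator_of_notMem fun h => hc1 h.2]
      convert! measure_empty (μ := (volume : Measure ℝ))
      ext x
      simp only [Set.mem_ofPred_eq, mem_empty_iff_false, iff_false, not_lt]
      have := ENNReal.toReal_mono one_ne_top (hf1 x)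
      rw [toReal_one] at this
      linarith [not_lt.1 hc1]
  rw [h1, setLIntegral_congr_fun measurableSet_Ioi h2, setLIntegral_indicator measurableSet_Ioo,
    inter_eq_left.2 fun x hx => hx.1]

variable {s t : ℝ≥0}

/-- With suprema equal to 1, the superlevel sets of f and g are nonempty at every level c < 1, and
their weighted sum lies in that of h. Apply the one-dimensional Brunn–Minkowski inequality at each
level and integrate over c in (0, 1); h is truncated at 1 to match. -/
theorem add_lintegral_le_lintegral_of_iSup_eq_one {f g h : ℝ → ℝ≥0∞} (hf : Measurable f)
    (hg : Measurable g) (hh : Measurable h) (hs : s ≠ 0) (ht : t ≠ 0) (hst : s + t = 1)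
    (hf1 : ⨆ x, f x = 1) (hg1 : ⨆ x, g x = 1)
    (hfgh : ∀ x y, f x ^ (s : ℝ) * g y ^ (t : ℝ) ≤ h (s * x + t * y)) :
    s * (∫⁻ x, f x) + t * ∫⁻ x, g x ≤ ∫⁻ x, h x := by
  have hfle : ∀ x, f x ≤ 1 := fun x => (le_iSup f x).trans hf1.le
  have hgle : ∀ x, g x ≤ 1 := fun x => (le_iSup g x).trans hg1.le
  have hs0 : (0 : ℝ) < s := NNReal.coe_pos.2 (pos_iff_ne_zero.2 hs)
  have ht0 : (0 : ℝ) < t := NNReal.coe_pos.2 (pos_iff_ne_zero.2 ht)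
  have hmeas : ∀ {F : ℝ → ℝ≥0∞}, Measurable fun c : ℝ => volume {x | ENNReal.ofReal c < F x} := by
    intro F
    refine Antitone.measurable fun c d hcd => measure_mono fun x hx => ?_
    exact (ENNReal.ofReal_le_ofReal hcd).trans_lt hx
  calc s * (∫⁻ x, f x) + t * ∫⁻ x, g x
      = ∫⁻ c in Ioo (0 : ℝ) 1, (s * volume {x | ENNReal.ofReal c < f x} +
          t * volume {x | ENNReal.ofReal c < g x}) := by
        rw [lintegral_eq_lintegral_Ioo_of_le_one hf hfle,
          lintegral_eq_lintegral_Ioo_of_le_one hg hgle, lintegral_add_left (hmeas.const_mul _),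
          lintegral_const_mul _ hmeas, lintegral_const_mul _ hmeas]
    _ ≤ ∫⁻ c in Ioo (0 : ℝ) 1, volume {x | ENNReal.ofReal c < min (h x) 1} := by
        refine setLIntegral_mono hmeas fun c hc => ?_
        have hc1 : ENNReal.ofReal c < 1 := by
          rw [← ENNReal.ofReal_one]
          exact (ENNReal.ofReal_lt_ofReal_iff one_pos).2 hc.2
        have hne : ∀ {F : ℝ → ℝ≥0∞}, ⨆ x, F x = 1 → {x | ENNReal.ofReal c < F x}.Nonempty :=
          fun hF => lt_iSup_iff.1 (hc1.trans_eq hF.symm)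
        refine add_volume_le_volume_of_nonempty (measurableSet_lt measurable_const hf)
          (measurableSet_lt measurable_const hg) (hne hf1) (hne hg1) fun a ha b hb => ?_
        refine lt_min (lt_of_lt_of_le ?_ (hfgh a b)) hc1
        have hc0 : ENNReal.ofReal c ≠ 0 := by simpa using hc.1
        calc ENNReal.ofReal c
            = ENNReal.ofReal c ^ (s : ℝ) * ENNReal.ofReal c ^ (t : ℝ) := by
              rw [← ENNReal.rpow_add _ _ hc0 ENNReal.ofReal_ne_top, ← NNReal.coe_add, hst]
              simp
          _ < f a ^ (s : ℝ) * g b ^ (t : ℝ) :=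
              ENNReal.mul_lt_mul (ENNReal.rpow_lt_rpow ha hs0) (ENNReal.rpow_lt_rpow hb ht0)
    _ = ∫⁻ x, min (h x) 1 :=
        (lintegral_eq_lintegral_Ioo_of_le_one (hh.min measurable_const) fun x => min_le_right _
          _).symm
    _ ≤ ∫⁻ x, h x := lintegral_mono fun x => min_le_left _ _

/-- Boundedness makes the suprema finite. Dividing f and g by them reduces to the additive
inequality, which dominates the geometric one by weighted AM–GM. -/
theorem prekopa_leindler_real_of_le {f g h : ℝ → ℝ≥0∞} (hf : Measurable f)
    (hg : Measurable g) (hh : Measurable h) (hs : s ≠ 0) (ht : t ≠ 0) (hst : s + t = 1)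
    {N : ℝ≥0} (hfN : ∀ x, f x ≤ N) (hgN : ∀ x, g x ≤ N)
    (hfgh : ∀ x y, f x ^ (s : ℝ) * g y ^ (t : ℝ) ≤ h (s * x + t * y)) :
    (∫⁻ x, f x) ^ (s : ℝ) * (∫⁻ x, g x) ^ (t : ℝ) ≤ ∫⁻ x, h x := by
  have hs0 : (0 : ℝ) < s := NNReal.coe_pos.2 (pos_iff_ne_zero.2 hs)
  have ht0 : (0 : ℝ) < t := NNReal.coe_pos.2 (pos_iff_ne_zero.2 ht)
  set a := ⨆ x, f x with ha
  set b := ⨆ x, g x with hb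
  have haN : a ≠ ⊤ := ((iSup_le hfN).trans_lt coe_lt_top).ne
  have hbN : b ≠ ⊤ := ((iSup_le hgN).trans_lt coe_lt_top).ne
  rcases eq_or_ne a 0 with ha0 | ha0
  · have : ∀ x, f x = 0 := fun x => le_antisymm ((le_iSup f x).trans ha0.le) bot_le
    simp [this, hs0]
  rcases eq_or_ne b 0 with hb0 | hb0
  · have : ∀ x, g x = 0 := fun x => le_antisymm ((le_iSup g x).trans hb0.le) bot_le
    simp [this, ht0]
  set c := a⁻¹ ^ (s : ℝ) * b⁻¹ ^ (t : ℝ) with hc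
  have hc0 : c ≠ 0 := mul_ne_zero (by simp [haN, ha0]) (by simp [hbN, hb0])
  have hct : c ≠ ⊤ := ENNReal.mul_ne_top (ENNReal.rpow_ne_top_of_nonneg hs0.le (by simpa))
    (ENNReal.rpow_ne_top_of_nonneg ht0.le (by simpa))
  have key := add_lintegral_le_lintegral_of_iSup_eq_one (f := fun x => a⁻¹ * f x)
    (g := fun x => b⁻¹ * g x) (h := fun x => c * h x) (hf.const_mul _) (hg.const_mul _)
    (hh.const_mul _) hs ht hst
    (by rw [← ENNReal.mul_iSup, ENNReal.inv_mul_cancel ha0 haN])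
    (by rw [← ENNReal.mul_iSup, ENNReal.inv_mul_cancel hb0 hbN])
    (fun x y => by
      rw [ENNReal.mul_rpow_of_nonneg _ _ hs0.le, ENNReal.mul_rpow_of_nonneg _ _ ht0.le,
        mul_mul_mul_comm]
      exact mul_le_mul_right (hfgh x y) c)
  have h2 := (ENNReal.geom_mean_le_arith_mean2_weighted hs ht hst _ _).trans key
  rw [lintegral_const_mul _ hf, lintegral_const_mul _ hg, lintegral_const_mul _ hh,
    ENNReal.mul_rpow_of_nonneg _ _ hs0.le, ENNReal.mul_rpow_of_nonneg _ _ ht0.le,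
    mul_mul_mul_comm] at h2
  exact (ENNReal.mul_le_mul_iff_right hc0 hct).1 h2

theorem prekopa_leindler_real {f g h : ℝ → ℝ≥0∞} (hf : Measurable f)
    (hg : Measurable g) (hh : Measurable h) (hs : s ≠ 0) (ht : t ≠ 0) (hst : s + t = 1)
    (hfgh : ∀ x y, f x ^ (s : ℝ) * g y ^ (t : ℝ) ≤ h (s * x + t * y)) :
    (∫⁻ x, f x) ^ (s : ℝ) * (∫⁻ x, g x) ^ (t : ℝ) ≤ ∫⁻ x, h x := by
  have hs0 : (0 : ℝ) < s := NNReal.coe_pos.2 (pos_iff_ne_zero.2 hs)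
  have ht0 : (0 : ℝ) < t := NNReal.coe_pos.2 (pos_iff_ne_zero.2 ht)
  have hmono : ∀ F : ℝ → ℝ≥0∞, Monotone fun (N : ℕ) (x : ℝ) => min (F x) (N : ℝ≥0∞) :=
    fun F N M hNM x => min_le_min_left _ (by exact_mod_cast hNM)
  have hsup : ∀ {F : ℝ → ℝ≥0∞}, Measurable F →
      ∫⁻ x, F x = ⨆ N : ℕ, ∫⁻ x, min (F x) (N : ℝ≥0∞) := by
    intro F hF
    rw [← lintegral_iSup (fun N => hF.min measurable_const) (hmono F)]
    refine lintegral_congr fun x => ?_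
    rw [← inf_iSup_eq, ENNReal.iSup_natCast, inf_top_eq]
  have hrpow : ∀ {r : ℝ} (hr : 0 < r) (a : ℕ → ℝ≥0∞), (⨆ N, a N) ^ r = ⨆ N, a N ^ r :=
    fun hr a => (ENNReal.orderIsoRpow _ hr).map_iSup a
  rw [hsup hf, hsup hg, hrpow hs0, hrpow ht0, ENNReal.iSup_mul]
  refine iSup_le fun N => ?_
  rw [ENNReal.mul_iSup]
  refine iSup_le fun M => ?_
  set K := max N M with hK
  refine le_trans (mul_le_mul' (ENNReal.rpow_le_rpow (lintegral_mono (hmono f (le_max_left N M)))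
    hs0.le) (ENNReal.rpow_le_rpow (lintegral_mono (hmono g (le_max_right N M))) ht0.le))
    (prekopa_leindler_real_of_le (f := fun x => min (f x) (K : ℝ≥0∞))
      (g := fun x => min (g x) (K : ℝ≥0∞)) (hf.min measurable_const) (hg.min measurable_const) hh
        hs ht hst
      (N := (K : ℝ≥0)) (fun x => (min_le_right _ _).trans (by simp)) (fun x => (min_le_right _
        _).trans (by simp))
      fun x y => ?_)
  exact le_trans (mul_le_mul' (ENNReal.rpow_le_rpow (min_le_left _ _) hs0.le)
    (ENNReal.rpow_le_rpow (min_le_left _ _) ht0.le)) (hfgh x y)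

/-- The Prékopa–Leindler inequality. -/
theorem prekopa_leindler {n : ℕ} {f g h : (Fin n → ℝ) → ℝ≥0∞} (hf : Measurable f)
    (hg : Measurable g) (hh : Measurable h) (hs : s ≠ 0) (ht : t ≠ 0) (hst : s + t = 1)
    (hfgh : ∀ x y, f x ^ (s : ℝ) * g y ^ (t : ℝ) ≤ h ((s : ℝ) • x + (t : ℝ) • y)) :
    (∫⁻ x, f x) ^ (s : ℝ) * (∫⁻ x, g x) ^ (t : ℝ) ≤ ∫⁻ x, h x := by
  induction n with
  | zero =>
    have h0 : ∀ F : (Fin 0 → ℝ) → ℝ≥0∞, ∫⁻ x, F x = F default := fun F => by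
      rw [lintegral_unique, Measure.volume_pi_eq_dirac default]
      simp only [measure_univ, mul_one]
      exact congrArg F (Subsingleton.elim _ _)
    rw [h0, h0, h0]
    exact (hfgh default default).trans_eq (congrArg h (Subsingleton.elim _ _))
  | succ n ih =>
    set e := (MeasurableEquiv.piFinSuccAbove (fun _ : Fin (n + 1) => ℝ) 0).symm with he
    have hmp : MeasurePreserving e :=
      (volume_preserving_piFinSuccAbove (fun _ : Fin (n + 1) => ℝ) 0).symm _
    have hFub : ∀ {F : (Fin (n + 1) → ℝ) → ℝ≥0∞}, Measurable F →
        ∫⁻ x, F x = ∫⁻ r, ∫⁻ y, F (e (r, y)) := by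
      intro F hF
      rw [← hmp.lintegral_comp hF, Measure.volume_eq_prod,
        lintegral_prod (fun p => F (e p)) (hF.comp e.measurable).aemeasurable]
    have hmeas : ∀ {F : (Fin (n + 1) → ℝ) → ℝ≥0∞}, Measurable F →
        Measurable fun r => ∫⁻ y, F (e (r, y)) := fun hF =>
      (hF.comp e.measurable).lintegral_prod_right'
    have hadd : ∀ (r r' : ℝ) (y y' : Fin n → ℝ), (s : ℝ) • e (r, y) + (t : ℝ) • e (r', y') =
        e (s * r + t * r', (s : ℝ) • y + (t : ℝ) • y') := by
      intro r r' y y'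
      ext i
      refine Fin.cases ?_ (fun j => ?_) i <;>
      simp [he, MeasurableEquiv.piFinSuccAbove]
    rw [hFub hf, hFub hg, hFub hh]
    -- The induction hypothesis on slices is exactly the one-dimensional hypothesis for the slice
    -- integrals.
    refine prekopa_leindler_real (hmeas hf) (hmeas hg) (hmeas hh) hs ht hst fun r r' => ?_
    refine ih (hf.comp (e.measurable.comp measurable_prodMk_left))
      (hg.comp (e.measurable.comp measurable_prodMk_left))
      (hh.comp (e.measurable.comp measurable_prodMk_left)) fun y y' => ?_
    have := hfgh (e (r, y)) (e (r', y'))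
    rwa [hadd] at this

/-- The multiplicative form of the Brunn–Minkowski inequality. -/
theorem volume_rpow_mul_volume_rpow_le {n : ℕ} {K L C : Set (EuclideanSpace ℝ (Fin n))}
    (hK : MeasurableSet K) (hL : MeasurableSet L) (hC : MeasurableSet C) (hs : s ≠ 0) (ht : t ≠ 0)
    (hst : s + t = 1) (h : ∀ x ∈ K, ∀ y ∈ L, (s : ℝ) • x + (t : ℝ) • y ∈ C) :
    volume K ^ (s : ℝ) * volume L ^ (t : ℝ) ≤ volume C := by
  have hmp := PiLp.volume_preserving_toLp (Fin n)
  have hs0 : (0 : ℝ) < s := NNReal.coe_pos.2 (pos_iff_ne_zero.2 hs)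
  have ht0 : (0 : ℝ) < t := NNReal.coe_pos.2 (pos_iff_ne_zero.2 ht)
  have hind : ∀ {S : Set (EuclideanSpace ℝ (Fin n))}, MeasurableSet S →
      ∫⁻ x, (WithLp.toLp 2 ⁻¹' S).indicator 1 x = volume S := fun hS => by
    rw [lintegral_indicator_one (hmp.measurable hS), hmp.measure_preimage hS.nullMeasurableSet]
  rw [← hind hK, ← hind hL, ← hind hC]
  have hm : ∀ {S : Set (EuclideanSpace ℝ (Fin n))}, MeasurableSet S →
      Measurable ((WithLp.toLp 2 ⁻¹' S).indicator (1 : (Fin n → ℝ) → ℝ≥0∞)) := fun hS =>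
    measurable_one.indicator (hmp.measurable hS)
  refine prekopa_leindler (hm hK) (hm hL) (hm hC) hs ht hst fun x y => ?_
  by_cases hx : WithLp.toLp 2 x ∈ K
  · by_cases hy : WithLp.toLp 2 y ∈ L
    · have hxy : (s : ℝ) • x + (t : ℝ) • y ∈ WithLp.toLp 2 ⁻¹' C := h _ hx _ hy
      rw [Set.indicator_of_mem (show x ∈ WithLp.toLp 2 ⁻¹' K from hx),
        Set.indicator_of_mem (show y ∈ WithLp.toLp 2 ⁻¹' L from hy), Set.indicator_of_mem hxy]
      simp
    · rw [Set.indicator_of_notMem (show y ∉ WithLp.toLp 2 ⁻¹' L from hy),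
        ENNReal.zero_rpow_of_pos ht0, mul_zero]
      exact zero_le
  · rw [Set.indicator_of_notMem (show x ∉ WithLp.toLp 2 ⁻¹' K from hx),
      ENNReal.zero_rpow_of_pos hs0, zero_mul]
    exact zero_le

end PrekopaLeindler

/-! ### The Brunn–Minkowski inequality. -/

section BrunnMinkowski

open Pointwise

variable {n : ℕ} {K L C : Set (EuclideanSpace ℝ (Fin n))} {s t : ℝ}

theorem volume_vadd_smul_toReal_rpow (hn : n ≠ 0) (ht : 0 ≤ t) (v : EuclideanSpace ℝ (Fin n)) :
    (volume (v +ᵥ t • K)).toReal ^ (1 / (n : ℝ)) = t * (volume K).toReal ^ (1 / (n : ℝ)) := by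
  rw [measure_vadd, Measure.addHaar_smul, finrank_euclideanSpace_fin,
    abs_of_nonneg (pow_nonneg ht n), ENNReal.toReal_mul, ENNReal.toReal_ofReal (pow_nonneg ht n),
    Real.mul_rpow (pow_nonneg ht n) ENNReal.toReal_nonneg, one_div, Real.pow_rpow_inv_natCast ht hn]

theorem mul_volume_rpow_le_of_vadd_smul_subset (hn : n ≠ 0) (ht : 0 ≤ t)
    (hC : volume C ≠ ⊤) {v : EuclideanSpace ℝ (Fin n)} (h : v +ᵥ t • K ⊆ C) :
    t * (volume K).toReal ^ (1 / (n : ℝ)) ≤ (volume C).toReal ^ (1 / (n : ℝ)) := by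
  rw [← volume_vadd_smul_toReal_rpow hn ht v]
  exact Real.rpow_le_rpow ENNReal.toReal_nonneg (ENNReal.toReal_mono hC (measure_mono h))
    (by positivity)

/-- The Brunn–Minkowski inequality. -/
theorem brunn_minkowski (hn : n ≠ 0) (hK : MeasurableSet K) (hL : MeasurableSet L)
    (hC : MeasurableSet C) (hKne : K.Nonempty) (hLne : L.Nonempty) (hKv : volume K ≠ ⊤)
    (hLv : volume L ≠ ⊤) (hCv : volume C ≠ ⊤) (hs : 0 < s) (ht : 0 < t)
    (h : ∀ x ∈ K, ∀ y ∈ L, s • x + t • y ∈ C) :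
    s * (volume K).toReal ^ (1 / (n : ℝ)) + t * (volume L).toReal ^ (1 / (n : ℝ)) ≤
      (volume C).toReal ^ (1 / (n : ℝ)) := by
  set a := (volume K).toReal ^ (1 / (n : ℝ)) with ha
  set b := (volume L).toReal ^ (1 / (n : ℝ)) with hb
  have hn1 : (1 / (n : ℝ)) ≠ 0 := by positivity
  have ha0 : 0 ≤ a := Real.rpow_nonneg ENNReal.toReal_nonneg _
  have hb0 : 0 ≤ b := Real.rpow_nonneg ENNReal.toReal_nonneg _
  obtain ⟨k, hk⟩ := hKne
  obtain ⟨l, hl⟩ := hLne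
  rcases ha0.eq_or_lt' with ha0 | ha0
  · rw [ha0, mul_zero, zero_add]
    refine mul_volume_rpow_le_of_vadd_smul_subset (v := s • k) hn ht.le hCv ?_
    rintro _ ⟨_, ⟨y, hy, rfl⟩, rfl⟩
    exact h k hk y hy
  rcases hb0.eq_or_lt' with hb0 | hb0
  · rw [hb0, mul_zero, add_zero]
    refine mul_volume_rpow_le_of_vadd_smul_subset (v := t • l) hn hs.le hCv ?_
    rintro _ ⟨_, ⟨x, hx, rfl⟩, rfl⟩
    simp only [vadd_eq_add]
    rw [add_comm]
    exact h x hx l hl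
  set S := s * a + t * b with hS
  have hS0 : 0 < S := by positivity
  have hscale : ∀ {c : ℝ} {Q : Set (EuclideanSpace ℝ (Fin n))}, 0 < c →
      volume (c⁻¹ • Q) = ENNReal.ofReal ((c ^ n)⁻¹) * volume Q := fun {c Q} hc => by
    rw [Measure.addHaar_smul, finrank_euclideanSpace_fin, inv_pow,
      abs_of_nonneg (by positivity)]
  have hunit : ∀ {Q : Set (EuclideanSpace ℝ (Fin n))}, volume Q ≠ ⊤ →
      0 < (volume Q).toReal ^ (1 / (n : ℝ)) →
      volume (((volume Q).toReal ^ (1 / (n : ℝ)))⁻¹ • Q) = 1 := fun {Q} hQ hpos => by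
    have hne : (volume Q).toReal ≠ 0 := fun h0 => by
      rw [h0, Real.zero_rpow hn1] at hpos
      exact hpos.false
    rw [hscale hpos, one_div, Real.rpow_inv_natCast_pow ENNReal.toReal_nonneg hn,
      ← ENNReal.ofReal_toReal hQ, ENNReal.toReal_ofReal ENNReal.toReal_nonneg,
      ← ENNReal.ofReal_mul (inv_nonneg.2 ENNReal.toReal_nonneg), inv_mul_cancel₀ hne,
      ENNReal.ofReal_one]
  have hmeas : ∀ {c : ℝ} {Q : Set (EuclideanSpace ℝ (Fin n))}, 0 < c → MeasurableSet Q →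
      MeasurableSet (c⁻¹ • Q) := fun hc hQ => hQ.const_smul_of_ne_zero (inv_ne_zero hc.ne')
  -- Normalise K and L to unit volume. With weights sa/S and tb/S their combinations lie in S⁻¹C, so
  -- the multiplicative form gives |S⁻¹C| ≥ 1.
  have key := volume_rpow_mul_volume_rpow_le (s := ⟨s * a / S, by positivity⟩)
    (t := ⟨t * b / S, by positivity⟩) (hmeas ha0 hK) (hmeas hb0 hL) (hmeas hS0 hC)
    (fun h0 => (show (0 : ℝ) < s * a / S by positivity).ne' (congrArg NNReal.toReal h0))
    (fun h0 => (show (0 : ℝ) < t * b / S by positivity).ne' (congrArg NNReal.toReal h0))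
    (NNReal.eq (show s * a / S + t * b / S = 1 by rw [← add_div, ← hS, div_self hS0.ne']))
    (by
      rintro _ ⟨x, hx, rfl⟩ _ ⟨y, hy, rfl⟩
      refine ⟨s • x + t • y, h x hx y hy, ?_⟩
      simp only [smul_add, smul_smul]
      rw [show S⁻¹ * s = s * a / S * a⁻¹ by field_simp, show S⁻¹ * t = t * b / S * b⁻¹ by
        field_simp]
      rfl)
  rw [hunit hKv ha0, hunit hLv hb0, ENNReal.one_rpow, ENNReal.one_rpow, one_mul, hscale hS0] at key
  have hreal : S ^ n ≤ (volume C).toReal := by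
    have := ENNReal.toReal_mono (ENNReal.mul_ne_top ENNReal.ofReal_ne_top hCv) key
    rw [ENNReal.toReal_one, ENNReal.toReal_mul, ENNReal.toReal_ofReal (by positivity),
      inv_mul_eq_div, one_le_div (by positivity)] at this
    exact this
  calc S = (S ^ n) ^ (1 / (n : ℝ)) := by rw [one_div, Real.pow_rpow_inv_natCast hS0.le hn]
    _ ≤ (volume C).toReal ^ (1 / (n : ℝ)) :=
      Real.rpow_le_rpow (by positivity) hreal (by positivity)

end BrunnMinkowski

/-! ### Wulff shapes: concavity and continuity of the volume radius. -/

section WulffShape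

open Set Filter Topology Pointwise

variable {n : ℕ}

/-- The intersection of the half-spaces `{ζ | ⟨ζ, ξ⟩ ≤ h ξ}`, `ξ` in the unit sphere. -/
def wulffShape (h : C(sphere (0 : EuclideanSpace ℝ (Fin n)) 1, ℝ)) :
    Set (EuclideanSpace ℝ (Fin n)) :=
  {ζ | ∀ ξ : sphere (0 : EuclideanSpace ℝ (Fin n)) 1, inner ℝ ζ (ξ : EuclideanSpace ℝ (Fin n)) ≤ h
    ξ}

/-- The `n`-th root of the volume of the Wulff shape. -/
noncomputable def wulffRadius (h : C(sphere (0 : EuclideanSpace ℝ (Fin n)) 1, ℝ)) : ℝ :=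
  (volume (wulffShape h)).toReal ^ (1 / (n : ℝ))

variable {h h' : C(sphere (0 : EuclideanSpace ℝ (Fin n)) 1, ℝ)}

theorem isClosed_wulffShape : IsClosed (wulffShape h) := by
  rw [wulffShape, ofPred_forall]
  exact isClosed_iInter fun ξ => isClosed_le (by fun_prop) continuous_const

theorem wulffShape_mono (hh : ∀ ξ, h ξ ≤ h' ξ) : wulffShape h ⊆ wulffShape h' :=
  fun _ hζ ξ => (hζ ξ).trans (hh ξ)

theorem norm_le_of_mem_wulffShape {ζ : EuclideanSpace ℝ (Fin n)} (hζ : ζ ∈ wulffShape h) :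
    ‖ζ‖ ≤ ‖h‖ := by
  rcases eq_or_ne ζ 0 with rfl | h0
  · simp
  have hpos : 0 < ‖ζ‖ := norm_pos_iff.2 h0
  have h1 := hζ ⟨‖ζ‖⁻¹ • ζ, by simp [norm_smul, hpos.ne']⟩
  rw [inner_smul_right, real_inner_self_eq_norm_sq, pow_two, inv_mul_cancel_left₀ hpos.ne'] at h1
  exact h1.trans ((le_abs_self _).trans (h.norm_coe_le_norm _))

theorem isCompact_wulffShape : IsCompact (wulffShape h) :=
  (isCompact_closedBall (0 : EuclideanSpace ℝ (Fin n)) ‖h‖).of_isClosed_subset isClosed_wulffShape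
    fun _ hζ => mem_closedBall_zero_iff.2 (norm_le_of_mem_wulffShape hζ)

theorem volume_wulffShape_ne_top : volume (wulffShape h) ≠ ⊤ :=
  isCompact_wulffShape.measure_lt_top.ne

theorem smul_add_smul_mem_wulffShape {s t : ℝ} (hs : 0 ≤ s) (ht : 0 ≤ t)
    {x y : EuclideanSpace ℝ (Fin n)} (hx : x ∈ wulffShape h) (hy : y ∈ wulffShape h') :
    s • x + t • y ∈ wulffShape (s • h + t • h') := fun ξ => by
  rw [inner_add_left, real_inner_smul_left, real_inner_smul_left]
  exact add_le_add (mul_le_mul_of_nonneg_left (hx ξ) hs) (mul_le_mul_of_nonneg_left (hy ξ) ht)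

theorem convex_wulffShape : Convex ℝ (wulffShape h) := fun x hx y hy s t hs ht hst => by
  have := smul_add_smul_mem_wulffShape hs ht hx hy
  rwa [← add_smul, hst, one_smul] at this

theorem convex_setOf_wulffShape_nonempty :
    Convex ℝ {h : C(sphere (0 : EuclideanSpace ℝ (Fin n)) 1, ℝ) | (wulffShape h).Nonempty} := by
  rintro h ⟨x, hx⟩ h' ⟨y, hy⟩ s t hs ht -
  exact ⟨_, smul_add_smul_mem_wulffShape hs ht hx hy⟩

/-- Points chosen in the Wulff shapes of a convergent sequence stay bounded, and a cluster point
lies in the limit shape. Jensen's inequality and averaging both require a closed convex set. -/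
theorem isClosed_setOf_wulffShape_nonempty :
    IsClosed {h : C(sphere (0 : EuclideanSpace ℝ (Fin n)) 1, ℝ) | (wulffShape h).Nonempty} := by
  refine IsSeqClosed.isClosed fun h h₀ hne hlim => ?_
  choose ζ hζ using hne
  obtain ⟨C, hC⟩ := hlim.norm.bddAbove_range
  have hb : ∀ k, ζ k ∈ closedBall (0 : EuclideanSpace ℝ (Fin n)) C := fun k =>
    mem_closedBall_zero_iff.2 ((norm_le_of_mem_wulffShape (hζ k)).trans (hC ⟨k, rfl⟩))
  obtain ⟨z, -, φ, hφ, hz⟩ := tendsto_subseq_of_bounded isBounded_closedBall hb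
  refine ⟨z, fun ξ => ?_⟩
  have h1 : Tendsto (fun k => inner ℝ (ζ (φ k)) (ξ : EuclideanSpace ℝ (Fin n))) atTop
      (𝓝 (inner ℝ z (ξ : EuclideanSpace ℝ (Fin n)))) := hz.inner tendsto_const_nhds
  have h2 : Tendsto (fun k => h (φ k) ξ) atTop (𝓝 (h₀ ξ)) :=
    ((continuous_eval_const ξ).tendsto h₀).comp (hlim.comp hφ.tendsto_atTop)
  exact le_of_tendsto_of_tendsto' h1 h2 fun k => hζ _ ξ

theorem concaveOn_wulffRadius (hn : n ≠ 0) :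
    ConcaveOn ℝ {h : C(sphere (0 : EuclideanSpace ℝ (Fin n)) 1, ℝ) | (wulffShape h).Nonempty}
      wulffRadius :=
  concaveOn_iff_forall_pos.2 ⟨convex_setOf_wulffShape_nonempty, fun _ hx _ hy _ _ hs ht _ =>
    brunn_minkowski hn isClosed_wulffShape.measurableSet isClosed_wulffShape.measurableSet
      isClosed_wulffShape.measurableSet hx hy volume_wulffShape_ne_top volume_wulffShape_ne_top
      volume_wulffShape_ne_top hs ht
      fun _ hu _ hv => smul_add_smul_mem_wulffShape hs.le ht.le hu hv⟩

theorem abs_apply_sub_le (h h' : C(sphere (0 : EuclideanSpace ℝ (Fin n)) 1, ℝ))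
    (ξ : sphere (0 : EuclideanSpace ℝ (Fin n)) 1) : |h ξ - h' ξ| ≤ dist h h' := by
  rw [← Real.dist_eq]
  exact ContinuousMap.dist_apply_le_dist ξ

theorem wulffRadius_mono (hh : ∀ ξ, h ξ ≤ h' ξ) : wulffRadius h ≤ wulffRadius h' :=
  Real.rpow_le_rpow ENNReal.toReal_nonneg
    (ENNReal.toReal_mono volume_wulffShape_ne_top (measure_mono (wulffShape_mono hh)))
    (by positivity)

theorem tendsto_wulffRadius_add_const (hn : n ≠ 0)
    (h : C(sphere (0 : EuclideanSpace ℝ (Fin n)) 1, ℝ)) :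
    Tendsto (fun ε : ℝ => wulffRadius (h + ContinuousMap.const _ ε)) (𝓝[>] 0)
      (𝓝 (wulffRadius h)) := by
  have hinter : ⋂ ε > (0 : ℝ), wulffShape (h + ContinuousMap.const _ ε) = wulffShape h := by
    refine Subset.antisymm (fun ζ hζ ξ => le_of_forall_pos_le_add fun ε hε => ?_)
      (subset_iInter₂ fun ε hε => wulffShape_mono fun ξ => le_add_of_nonneg_right (le_of_lt hε))
    exact mem_iInter₂.1 hζ ε hε ξ
  have key := tendsto_measure_biInter_gt (μ := (volume : Measure (EuclideanSpace ℝ (Fin n))))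
    (s := fun ε : ℝ => wulffShape (h + ContinuousMap.const _ ε)) (a := 0)
    (fun ε _ => isClosed_wulffShape.measurableSet.nullMeasurableSet)
    (fun ε δ _ hεδ => wulffShape_mono fun ξ => add_le_add le_rfl hεδ)
    ⟨1, one_pos, volume_wulffShape_ne_top⟩
  rw [hinter] at key
  exact ((ENNReal.tendsto_toReal volume_wulffShape_ne_top).comp key).rpow_const
    (Or.inr (by positivity))

theorem Convex.interior_nonempty_of_volume_ne_zero {K : Set (EuclideanSpace ℝ (Fin n))}
    (hK : Convex ℝ K) (h0 : volume K ≠ 0) : (interior K).Nonempty := by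
  by_contra hempty
  rw [not_nonempty_iff_eq_empty] at hempty
  refine h0 (measure_mono_null (subset_closure.trans ?_) (hK.addHaar_frontier volume))
  rw [frontier, hempty, sdiff_empty]

/-- The inner ball gives ⟨c, ξ⟩ + ρ ≤ h(ξ) for unit ξ. Shrinking W(h) towards c by the factor 1 - δ
therefore gains δρ in every constraint and lands in W(h'). -/
theorem one_sub_mul_wulffRadius_le (hn : n ≠ 0) {c : EuclideanSpace ℝ (Fin n)} {ρ : ℝ}
    (hρ : 0 < ρ) (hc : closedBall c ρ ⊆ wulffShape h) {δ : ℝ} (hδ : 0 ≤ δ) (hδ1 : δ ≤ 1)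
    (hh : ∀ ξ, h ξ - δ * ρ ≤ h' ξ) : (1 - δ) * wulffRadius h ≤ wulffRadius h' := by
  refine mul_volume_rpow_le_of_vadd_smul_subset (v := δ • c) hn (sub_nonneg.2 hδ1)
    volume_wulffShape_ne_top ?_
  rintro _ ⟨_, ⟨y, hy, rfl⟩, rfl⟩ ξ
  have hξ : ‖(ξ : EuclideanSpace ℝ (Fin n))‖ = 1 := norm_eq_of_mem_sphere ξ
  have h1 := hc (show c + ρ • (ξ : EuclideanSpace ℝ (Fin n)) ∈ closedBall c ρ by
    simp [norm_smul, abs_of_pos hρ]) ξ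
  rw [inner_add_left, real_inner_smul_left, real_inner_self_eq_norm_sq, hξ, one_pow, mul_one] at h1
  simp only [vadd_eq_add]
  rw [inner_add_left, real_inner_smul_left, real_inner_smul_left]
  have h2 := mul_le_mul_of_nonneg_left h1 hδ
  have h3 := mul_le_mul_of_nonneg_left (hy ξ) (sub_nonneg.2 hδ1)
  linarith [hh ξ]

/-- From above, compare with h + ε, whose Wulff shapes decrease to W(h). From below, only positive
volume matters; then W(h) contains a ball and the shrinking estimate applies with δ = dist h h' / ρ.
-/
theorem continuous_wulffRadius (hn : n ≠ 0) :
    Continuous (wulffRadius : C(sphere (0 : EuclideanSpace ℝ (Fin n)) 1, ℝ) → ℝ) := by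
  refine continuous_iff_continuousAt.2 fun h => tendsto_order.2 ⟨fun a ha => ?_, fun a ha => ?_⟩
  · have hnonneg : ∀ h' : C(sphere (0 : EuclideanSpace ℝ (Fin n)) 1, ℝ), 0 ≤ wulffRadius h' :=
      fun h' => Real.rpow_nonneg ENNReal.toReal_nonneg _
    rcases eq_or_ne (volume (wulffShape h)) 0 with h0 | h0
    · rw [wulffRadius, h0, ENNReal.toReal_zero, Real.zero_rpow (by positivity)] at ha
      exact Eventually.of_forall fun h' => ha.trans_le (hnonneg h')
    obtain ⟨c, hc⟩ := convex_wulffShape.interior_nonempty_of_volume_ne_zero h0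
    obtain ⟨ρ, hρ, hcρ⟩ := nhds_basis_closedBall.mem_iff.1 (mem_interior_iff_mem_nhds.1 hc)
    have hlim : Tendsto (fun h' => (1 - dist h h' / ρ) * wulffRadius h) (𝓝 h)
        (𝓝 ((1 - dist h h / ρ) * wulffRadius h)) :=
      Continuous.tendsto (by fun_prop) h
    rw [dist_self, zero_div, sub_zero, one_mul] at hlim
    filter_upwards [hlim.eventually (lt_mem_nhds ha), ball_mem_nhds h hρ] with h' h1 h2
    rw [mem_ball, dist_comm] at h2
    refine h1.trans_le (one_sub_mul_wulffRadius_le hn hρ hcρ (by positivity)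
      ((div_le_one hρ).2 h2.le) fun ξ => ?_)
    rw [div_mul_cancel₀ _ hρ.ne']
    linarith [(abs_le.1 (abs_apply_sub_le h h' ξ)).2]
  · obtain ⟨ε, hεa, hε⟩ := (((tendsto_wulffRadius_add_const hn h).eventually
      (gt_mem_nhds ha)).and self_mem_nhdsWithin).exists
    filter_upwards [ball_mem_nhds h hε] with h' hh'
    refine (wulffRadius_mono fun ξ => ?_).trans_lt hεa
    change h' ξ ≤ h ξ + ε
    linarith [(abs_le.1 (abs_apply_sub_le h' h ξ)).2, mem_ball.1 hh']

end WulffShape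

/-! ### Support functions and the Hausdorff metric. -/

section SupportFunction

variable {n : ℕ} {A : Set (EuclideanSpace ℝ (Fin n))}

theorem inner_le_supportFunction (hA : Bornology.IsBounded A) {ζ : EuclideanSpace ℝ (Fin n)}
    (hζ : ζ ∈ A) (ξ : EuclideanSpace ℝ (Fin n)) : inner ℝ ζ ξ ≤ supportFunction A ξ := by
  obtain ⟨R, hR⟩ := hA.exists_norm_le
  refine le_csSup ⟨R * ‖ξ‖, ?_⟩ ⟨ζ, hζ, rfl⟩
  rintro _ ⟨z, hz, rfl⟩
  exact (real_inner_le_norm z ξ).trans (mul_le_mul_of_nonneg_right (hR z hz) (norm_nonneg ξ))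

theorem supportFunction_le (hne : A.Nonempty) {ξ : EuclideanSpace ℝ (Fin n)} {c : ℝ}
    (h : ∀ ζ ∈ A, inner ℝ ζ ξ ≤ c) : supportFunction A ξ ≤ c := by
  refine csSup_le (hne.image _) ?_
  rintro _ ⟨z, hz, rfl⟩
  exact h z hz

theorem supportFunction_smul (hA : Bornology.IsBounded A) (hne : A.Nonempty) {r : ℝ} (hr : 0 < r)
    (ξ : EuclideanSpace ℝ (Fin n)) : supportFunction A (r • ξ) = r * supportFunction A ξ := by
  refine le_antisymm (supportFunction_le hne fun ζ hζ => ?_) ?_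
  · rw [inner_smul_right]
    exact mul_le_mul_of_nonneg_left (inner_le_supportFunction hA hζ ξ) hr.le
  · rw [← le_div_iff₀' hr]
    refine supportFunction_le hne fun ζ hζ => ?_
    rw [le_div_iff₀' hr, ← inner_smul_right]
    exact inner_le_supportFunction hA hζ _

theorem supportFunction_le_add_of_norm_le {R : ℝ} (hne : A.Nonempty) (hR : ∀ ζ ∈ A, ‖ζ‖ ≤ R)
    (ξ η : EuclideanSpace ℝ (Fin n)) :
    supportFunction A ξ ≤ supportFunction A η + R * dist ξ η := by
  refine supportFunction_le hne fun ζ hζ => ?_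
  have h1 := inner_le_supportFunction (isBounded_iff_forall_norm_le.2 ⟨R, hR⟩) hζ η
  have h2 := (real_inner_le_norm ζ (ξ - η)).trans
    (mul_le_mul_of_nonneg_right (hR ζ hζ) (norm_nonneg _))
  rw [inner_sub_right, ← dist_eq_norm] at h2
  linarith

theorem lipschitzWith_supportFunction {R : NNReal} (hne : A.Nonempty) (hR : ∀ ζ ∈ A, ‖ζ‖ ≤ R) :
    LipschitzWith R (supportFunction A) :=
  LipschitzWith.of_le_add_mul R fun ξ η => supportFunction_le_add_of_norm_le hne hR ξ η

namespace ConvexBody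

variable (K L : ConvexBody (EuclideanSpace ℝ (Fin n)))

theorem continuous_supportFunction : Continuous (supportFunction (K : Set (EuclideanSpace ℝ (Fin
    n)))) := by
  obtain ⟨R, hR⟩ := K.isBounded.exists_norm_le
  exact (lipschitzWith_supportFunction (R := R.toNNReal) K.nonempty fun ζ hζ =>
    (hR ζ hζ).trans (Real.le_coe_toNNReal R)).continuous

theorem supportFunction_le_add_dist (ξ : EuclideanSpace ℝ (Fin n)) :
    supportFunction (K : Set (EuclideanSpace ℝ (Fin n))) ξ ≤ supportFunction (L : Set
      (EuclideanSpace ℝ (Fin n))) ξ + dist K L * ‖ξ‖ := by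
  refine supportFunction_le K.nonempty fun ζ hζ => ?_
  obtain ⟨z, hz, hdist⟩ := L.isCompact.exists_infDist_eq_dist L.nonempty ζ
  have h1 : dist ζ z ≤ dist K L := by
    rw [← hdist, ← hausdorffDist_coe]
    exact infDist_le_hausdorffDist_of_mem hζ hausdorffEDist_ne_top
  have h2 := (real_inner_le_norm (ζ - z) ξ).trans
    (mul_le_mul_of_nonneg_right ((dist_eq_norm ζ z).symm.le.trans h1) (norm_nonneg ξ))
  rw [inner_sub_left] at h2
  linarith [inner_le_supportFunction L.isBounded hz ξ]

/-- The support function of a convex body, restricted to the unit sphere. -/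
noncomputable def sphereSupport : C(sphere (0 : EuclideanSpace ℝ (Fin n)) 1, ℝ) :=
  ⟨fun ξ => supportFunction (K : Set (EuclideanSpace ℝ (Fin n))) ξ,
    K.continuous_supportFunction.comp continuous_subtype_val⟩

theorem subset_wulffShape_sphereSupport : (K : Set (EuclideanSpace ℝ (Fin n))) ⊆ wulffShape
    K.sphereSupport :=
  fun _ hζ ξ => inner_le_supportFunction K.isBounded hζ ξ

theorem lipschitzWith_sphereSupport :
    LipschitzWith 1 (sphereSupport : ConvexBody (EuclideanSpace ℝ (Fin n)) → _) := by
  refine LipschitzWith.of_dist_le_mul fun K L => ?_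
  rw [NNReal.coe_one, one_mul]
  refine (ContinuousMap.dist_le dist_nonneg).2 fun ξ => ?_
  have hξ : ‖(ξ : EuclideanSpace ℝ (Fin n))‖ = 1 := norm_eq_of_mem_sphere ξ
  have h1 := K.supportFunction_le_add_dist L ξ
  have h2 := L.supportFunction_le_add_dist K ξ
  rw [hξ, mul_one] at h1 h2
  rw [dist_comm L K] at h2
  rw [Real.dist_eq, abs_le]
  simp only [sphereSupport, ContinuousMap.coe_mk]
  constructor <;> linarith

end ConvexBody

end SupportFunction

/-! ### Harmonic interpolation as a curve of Wulff shapes in C(S). -/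

section HarmonicInterpolation

open Set Filter Topology

variable {m n : ℕ} {Ω : Set (EuclideanSpace ℝ (Fin m))}
  {A : frontier Ω → ConvexBody (EuclideanSpace ℝ (Fin n))} {x : EuclideanSpace ℝ (Fin m)}

/-- The harmonic extension of the boundary family of support functions, on the unit sphere. -/
noncomputable def interpolatedSupport (A : frontier Ω → ConvexBody (EuclideanSpace ℝ (Fin n)))
    (x : EuclideanSpace ℝ (Fin m)) : C(sphere (0 : EuclideanSpace ℝ (Fin n)) 1, ℝ) :=
  ∫ τ, (A τ).sphereSupport ∂(harmonicMeasure Ω x)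

theorem IsSmoothlyBoundedDomain.isProbabilityMeasure_harmonicMeasure (hm : 1 ≤ m) (hΩ :
    IsSmoothlyBoundedDomain Ω) (hx : x ∈ Ω) :
    IsProbabilityMeasure (harmonicMeasure Ω x) :=
  (hΩ.isHarmonicMeasure_harmonicMeasure hm hx).1

theorem continuous_sphereSupport_comp (hA : Continuous A) : Continuous fun τ => (A
    τ).sphereSupport :=
  ConvexBody.lipschitzWith_sphereSupport.continuous.comp hA

theorem integrable_sphereSupport (hm : 1 ≤ m) (hΩ : IsSmoothlyBoundedDomain Ω) (hA : Continuous A)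
    (hx : x ∈ Ω) :
    Integrable (fun τ => (A τ).sphereSupport) (harmonicMeasure Ω x) := by
  have := hΩ.isProbabilityMeasure_harmonicMeasure hm hx
  have : CompactSpace (frontier Ω) := isCompact_iff_compactSpace.1 hΩ.isCompact_frontier
  exact (continuous_sphereSupport_comp hA).integrable_of_hasCompactSupport
    (HasCompactSupport.of_compactSpace _)

theorem interpolatedSupport_apply (hm : 1 ≤ m) (hΩ : IsSmoothlyBoundedDomain Ω) (hA : Continuous
    A) (hx : x ∈ Ω) (ξ : sphere (0 : EuclideanSpace ℝ (Fin n)) 1) :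
    interpolatedSupport A x ξ =
      ∫ τ, supportFunction (A τ : Set (EuclideanSpace ℝ (Fin n))) ξ ∂(harmonicMeasure Ω x) :=
  ((ContinuousMap.evalCLM ℝ ξ).integral_comp_comm
    (integrable_sphereSupport hm hΩ hA hx)).symm

/-- A Bochner average, against a probability measure, of elements of a closed convex set stays in
it. -/
theorem wulffShape_interpolatedSupport_nonempty (hm : 1 ≤ m) (hΩ : IsSmoothlyBoundedDomain Ω) (hA
    : Continuous A) (hx : x ∈ Ω) :
    (wulffShape (interpolatedSupport A x)).Nonempty := by
  have := hΩ.isProbabilityMeasure_harmonicMeasure hm hx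
  exact convex_setOf_wulffShape_nonempty.integral_mem isClosed_setOf_wulffShape_nonempty
    (Eventually.of_forall fun τ => (A τ).nonempty.mono (A τ).subset_wulffShape_sphereSupport)
    (integrable_sphereSupport hm hΩ hA hx)

theorem harmonicInterpolation_eq_wulffShape (hm : 1 ≤ m) (hΩ : IsSmoothlyBoundedDomain Ω) (hA :
    Continuous A) (hx : x ∈ Ω) :
    harmonicInterpolation Ω A x = wulffShape (interpolatedSupport A x) := by
  refine Subset.antisymm (fun ζ hζ ξ => ?_) fun ζ hζ ξ => ?_
  · rw [interpolatedSupport_apply hm hΩ hA hx]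
    exact hζ ξ
  · rcases eq_or_ne ξ 0 with rfl | h0
    · have : ∀ τ, supportFunction (A τ : Set (EuclideanSpace ℝ (Fin n))) 0 = 0 := fun τ => by
        simp [supportFunction, (A τ).nonempty]
      simp [this]
    · have hpos : 0 < ‖ξ‖ := norm_pos_iff.2 h0
      have h1 := hζ ⟨‖ξ‖⁻¹ • ξ, by simp [norm_smul, hpos.ne']⟩
      rw [interpolatedSupport_apply hm hΩ hA hx] at h1
      simp only [supportFunction_smul (A _).isBounded (A _).nonempty (inv_pos.2 hpos)] at h1
      rw [inner_smul_right, integral_const_mul] at h1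
      exact le_of_mul_le_mul_left h1 (inv_pos.2 hpos)

theorem harmonicOnNhd_integral_supportFunction (hm : 1 ≤ m) (hΩ : IsSmoothlyBoundedDomain Ω) (hA :
    Continuous A) (ξ : EuclideanSpace ℝ (Fin n)) :
    HarmonicOnNhd (fun x => ∫ τ, supportFunction (A τ : Set (EuclideanSpace ℝ (Fin n))) ξ
      ∂(harmonicMeasure Ω x)) Ω := by
  refine hΩ.harmonicOnNhd_integral_harmonicMeasure hm ⟨fun τ => supportFunction (A τ : Set
    (EuclideanSpace ℝ (Fin n))) ξ, ?_⟩
  refine (LipschitzWith.of_le_add_mul ‖ξ‖₊ fun K L => ?_ : LipschitzWith ‖ξ‖₊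
    fun K : ConvexBody (EuclideanSpace ℝ (Fin n)) => supportFunction (K : Set (EuclideanSpace ℝ
      (Fin n))) ξ).continuous.comp hA
  rw [coe_nnnorm, mul_comm]
  exact K.supportFunction_le_add_dist L ξ

/-- The bodies lie in a common ball of radius C, so the averages are C-Lipschitz in ξ uniformly in
x. For fixed ξ they are harmonic, hence continuous, in x. Joint continuity follows, and currying
turns it into continuity in the sup norm. -/
theorem continuousOn_interpolatedSupport (hm : 1 ≤ m) (hΩ : IsSmoothlyBoundedDomain Ω) (hA :
    Continuous A) : ContinuousOn (interpolatedSupport A) Ω := by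
  have : CompactSpace (frontier Ω) := isCompact_iff_compactSpace.1 hΩ.isCompact_frontier
  obtain ⟨C, hC⟩ := (isCompact_univ.image (continuous_sphereSupport_comp
    hA)).isBounded.exists_norm_le
  have hlip : ∀ τ, LipschitzWith C.toNNReal (supportFunction (A τ : Set (EuclideanSpace ℝ (Fin
    n)))) := fun τ =>
    lipschitzWith_supportFunction (A τ).nonempty fun ζ hζ =>
      ((norm_le_of_mem_wulffShape ((A τ).subset_wulffShape_sphereSupport hζ)).trans
        (hC _ ⟨τ, mem_univ τ, rfl⟩)).trans (Real.le_coe_toNNReal C)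
  have hjoint : Continuous fun p : Ω × sphere (0 : EuclideanSpace ℝ (Fin n)) 1 =>
      interpolatedSupport A p.1 p.2 := by
    refine continuous_prod_of_continuous_lipschitzWith' _ C.toNNReal (fun x => ?_) fun ξ => ?_
    · have := hΩ.isProbabilityMeasure_harmonicMeasure hm x.2
      have hint := fun ξ : sphere (0 : EuclideanSpace ℝ (Fin n)) 1 =>
        (ContinuousMap.evalCLM ℝ ξ).integrable_comp (integrable_sphereSupport hm hΩ hA x.2)
      refine LipschitzWith.of_le_add_mul _ fun ξ η => ?_
      change interpolatedSupport A x ξ ≤ interpolatedSupport A x η + _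
      rw [interpolatedSupport_apply hm hΩ hA x.2, interpolatedSupport_apply hm hΩ hA x.2]
      refine (integral_mono (hint ξ) ((hint η).add (integrable_const (C.toNNReal * dist ξ η)))
        fun τ => ?_).trans_eq ?_
      · exact (hlip τ).le_add_mul ξ η
      · rw [integral_add' (hint η) (integrable_const _), integral_const, probReal_univ, one_smul]
        rfl
    · refine (continuousOn_iff_continuous_domRestrict.1
        (harmonicOnNhd_integral_supportFunction hm hΩ hA ξ).continuousOn).congr fun x => ?_
      exact (interpolatedSupport_apply hm hΩ hA x.2 ξ).symm
  rw [continuousOn_iff_continuous_domRestrict]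
  exact (ContinuousMap.curry ⟨_, hjoint⟩).continuous

theorem average_interpolatedSupport (hm : 1 ≤ m) (hΩ : IsSmoothlyBoundedDomain Ω) (hA : Continuous
    A) {r : ℝ} (hr : 0 < r) (hxr : closedBall x r ⊆ Ω) :
    ⨍ θ : sphere (0 : EuclideanSpace ℝ (Fin m)) 1, interpolatedSupport A (x + r • (θ :
      EuclideanSpace ℝ (Fin m)))
      ∂(volume : Measure (EuclideanSpace ℝ (Fin m))).toSphere = interpolatedSupport A x := by
  have : Nonempty (Fin m) := ⟨⟨0, hm⟩⟩
  have hmem : ∀ θ : sphere (0 : EuclideanSpace ℝ (Fin m)) 1, x + r • (θ : EuclideanSpace ℝ (Fin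
    m)) ∈ Ω := fun θ =>
    hxr (by simp [norm_smul, abs_of_pos hr])
  -- The scalar mean value property is applied on a strictly larger open ball, which compactness
  -- provides.
  obtain ⟨δ, hδ, hδΩ⟩ := (isCompact_closedBall x r).exists_thickening_subset_open hΩ.isOpen hxr
  rw [thickening_closedBall hδ hr.le] at hδΩ
  have hint : Integrable (fun θ : sphere (0 : EuclideanSpace ℝ (Fin m)) 1 =>
      interpolatedSupport A (x + r • (θ : EuclideanSpace ℝ (Fin m))))
      (volume : Measure (EuclideanSpace ℝ (Fin m))).toSphere :=
    (continuous_comp_sphere (continuousOn_interpolatedSupport hm hΩ hA) hr.le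
      hxr).integrable_of_hasCompactSupport (HasCompactSupport.of_compactSpace _)
  ext ξ
  rw [interpolatedSupport_apply hm hΩ hA (hxr (mem_closedBall_self hr.le)),
    ← average_sphere_eq_of_harmonicOnNhd
      ((harmonicOnNhd_integral_supportFunction hm hΩ hA (ξ : EuclideanSpace ℝ (Fin n))).mono hδΩ)
      hr.le (lt_add_of_pos_left r hδ), average_eq, average_eq]
  refine (congrArg (fun y : ℝ => (_ : ℝ) • y) ((ContinuousMap.evalCLM ℝ ξ).integral_comp_comm
    hint).symm).trans ?_
  refine congrArg (fun y : ℝ => (_ : ℝ) • y) (integral_congr_ae (Eventually.of_forall fun θ => ?_))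
  exact interpolatedSupport_apply hm hΩ hA (hmem θ) ξ

end HarmonicInterpolation

/-- If `A_x` is the harmonic interpolation of a continuous family of convex bodies in `ℝⁿ`
parametrized by the boundary of a smoothly bounded domain `Ω`, then `x ↦ |A_x|^{1/n}` is
superharmonic on `Ω`. (`ConvexBody` carries the Hausdorff metric.) -/
theorem theorem2p2 {m n : ℕ} (hm : 1 ≤ m) (hn : 1 ≤ n)
    (Ω : Set (EuclideanSpace ℝ (Fin m))) (hΩ : IsSmoothlyBoundedDomain Ω)
    (A : frontier Ω → ConvexBody (EuclideanSpace ℝ (Fin n))) (hA : Continuous A) :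
    IsSuperharmonicOn
      (fun x => (volume (harmonicInterpolation Ω A x)).toReal ^ (1 / (n : ℝ))) Ω := by
  have hn0 : n ≠ 0 := Nat.one_le_iff_ne_zero.1 hn
  have hF := continuousOn_interpolatedSupport hm hΩ hA
  have heq : Set.EqOn (fun x => (volume (harmonicInterpolation Ω A x)).toReal ^ (1 / (n : ℝ)))
      (fun x => wulffRadius (interpolatedSupport A x)) Ω := fun x hx => by
    simp only [harmonicInterpolation_eq_wulffShape hm hΩ hA hx, wulffRadius]
  have hcont : ContinuousOn
      (fun x => (volume (harmonicInterpolation Ω A x)).toReal ^ (1 / (n : ℝ))) Ω :=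
    ((continuous_wulffRadius hn0).comp_continuousOn hF).congr heq
  refine ⟨hcont.lowerSemicontinuousOn, fun x r hr hxr => integrable_comp_sphere hcont hr.le hxr,
    fun x r hr hxr => ?_⟩
  have : Nonempty (Fin m) := ⟨⟨0, hm⟩⟩
  have : NeZero (volume : Measure (EuclideanSpace ℝ (Fin m))).toSphere :=
    ⟨Measure.toSphere_ne_zero _⟩
  have hmem : ∀ θ : sphere (0 : EuclideanSpace ℝ (Fin m)) 1, x + r • (θ : EuclideanSpace ℝ (Fin
    m)) ∈ Ω := fun θ =>
    hxr (by simp [norm_smul, abs_of_pos hr])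
  have hFc := continuous_comp_sphere hF hr.le hxr
  -- Jensen's inequality for the C(S)-valued map θ ↦ h_{x + rθ}, whose average is h_x.
  have hjensen := (concaveOn_wulffRadius hn0).le_map_average
    (μ := (volume : Measure (EuclideanSpace ℝ (Fin m))).toSphere)
    (continuous_wulffRadius hn0).continuousOn isClosed_setOf_wulffShape_nonempty
    (Filter.Eventually.of_forall fun θ =>
      wulffShape_interpolatedSupport_nonempty hm hΩ hA (hmem θ))
    (hFc.integrable_of_hasCompactSupport (HasCompactSupport.of_compactSpace _))
    (((continuous_wulffRadius hn0).comp hFc).integrable_of_hasCompactSupport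
      (HasCompactSupport.of_compactSpace _))
  rw [average_interpolatedSupport hm hΩ hA hr hxr] at hjensen
  refine le_trans (le_of_eq ?_) (hjensen.trans_eq (heq (hxr (mem_closedBall_self hr.le))).symm)
  rw [average_eq, average_eq]
  exact congrArg _ (integral_congr_ae (Filter.Eventually.of_forall fun θ => heq (hmem θ)))
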